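/- Fix $\delta\in(-1,\infty)$ and put $\tau=\tau(\delta)=3+\delta$. The \emph{Pólya point tree} with parameter $\delta$ (the local limit of the preferential attachment model in which each new vertex attaches one edge, with shift $\delta$) is the following random rooted tree. Every vertex $u$ has an age $A_u\in[0,1]$, and every vertex other than the root $\phi$ has a label $\mathsf{y}$ (younger than its parent) or $\mathsf{o}$ (older than its parent). The age $A_\phi$ is uniform on $[0,1]$. Given a vertex $u$ with its age and label, its children are as follows. (1) If $u=\phi$ or $u$ has label $\mathsf{o}$, then $u$ has exactly one child of label $\mathsf{o}$; this child has age $U^{\frac{2+\delta}{1+\delta}}A_u$, where $U$ is uniform on $[0,1]$ and independent of everything else. If $u$ has label $\mathsf{y}$, then it has no child of label $\mathsf{o}$. (2) The ages of the children of $u$ with label $\mathsf{y}$ are the points of a Poisson point process on $[A_u,1]$ with intensity $$\rho_u(x)=\frac{\Gamma_u}{2+\delta}\,\frac{x^{-(1+\delta)/(2+\delta)}}{A_u^{1/(2+\delta)}},$$ where $\Gamma_u$ is independent of everything else and has the Gamma distribution with rate $1$ and with shape $1+\delta$ if $u$ is the root or has label $\mathsf{y}$, and shape $2+\delta$ if $u$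 has label $\mathsf{o}$. Let $d_\phi$ be the number of children of $\phi$, let $d_1,\dots,d_{d_\phi}$ be the numbers of children of the children of $\phi$, and let $\mu$ be the law on $\mathbb R$ of the friendship bias of the root, $$\Delta_\phi=\Big[\frac1{d_\phi}\sum_{j=1}^{d_\phi}(d_j+1)-d_\phi\Big]\mathbf 1_{\{d_\phi\neq0\}}.$$ For positive functions $f,g$, write $f(x)\gtrsim g(x)$ if $\liminf_{x\to\infty}f(x)/g(x)>0$ and $f(x)\lesssim g(x)$ if $\limsup_{x\to\infty}f(x)/g(x)<\infty$. Then, as $x\to\infty$ through the real numbers, $$\mu([x,\infty))\gtrsim\begin{cases}x^{-(3\tau-4)},&\delta\in(-1,0),\\ x^{-(2\tau-1)},&\delta\in[0,\infty),\end{cases}$$ and $$\mu([x,\infty))\lesssim\begin{cases}x^{-(3-\tau)},&\delta\in[-\tfrac12,0),\\ x^{-1},&\delta=0,\\ x^{-(\tau-3)},&\delta\in(0,\infty).\end{cases}$$ -/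

import Mathlib

open MeasureTheory ProbabilityTheory Set Filter

noncomputable section

namespace PolyaPointTree

/-- Ulam-Harris words. The root is the empty word, and `j :: u` is the child of `u` with
(zero-based) index `j`: the letter appended last is the head of the list. -/
abbrev Word : Type := List ℕ

/-- The two labels: `y` for a vertex younger than its parent, `o` for a vertex older than its
parent. -/
inductive Label : Type
  | y
  | o
  deriving DecidableEq

/-- The label carried by the vertex with a given word; the root carries none. The first child of
the root and the first child of a vertex of label `o` have label `o`, all other vertices have
label `y`. -/
def label : Word → Option Label
  | [] => none
  | j :: u => if label u ≠ some Label.y ∧ j = 0 then some Label.o else some Label.y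

/-- The number of children of label `o`: one if the vertex is the root or has label `o`,
and zero otherwise. -/
def numOld (u : Word) : ℕ := if label u = some Label.y then 0 else 1

/-- The shape parameter of the Gamma variable attached to a vertex. -/
def gammaShape (δ : ℝ) (u : Word) : ℝ :=
  if label u = some Label.o then 2 + δ else 1 + δ

/-- The independent randomness attached to one vertex: a uniform variable `U`, a Gamma variable
`Γ`, and the interarrival times of a unit-rate Poisson process on `[0, ∞)`. -/
abbrev Noise : Type := ℝ × ℝ × (ℕ → ℝ)

instance : IsProbabilityMeasure (expMeasure 1) := isProbabilityMeasure_expMeasure one_pos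

/-- The law of the randomness attached to the vertex `u`: the three components are
independent, and the interarrival times are independent standard exponentials. -/
def noiseLaw (δ : ℝ) (u : Word) : Measure Noise :=
  (volume.restrict (Icc (0 : ℝ) 1)).prod
    ((gammaMeasure (gammaShape δ u) 1).prod (Measure.infinitePi fun _ : ℕ => expMeasure 1))

theorem isProbabilityMeasure_noiseLaw {δ : ℝ} (hδ : -1 < δ) (u : Word) :
    IsProbabilityMeasure (noiseLaw δ u) := by
  have h1 : IsProbabilityMeasure (volume.restrict (Icc (0 : ℝ) 1)) := ⟨by simp⟩
  have h2 : IsProbabilityMeasure (gammaMeasure (gammaShape δ u) 1) := by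
    apply isProbabilityMeasure_gammaMeasure _ one_pos
    unfold gammaShape
    split_ifs <;> linarith
  unfold noiseLaw
  infer_instance

/-- The sample space: independent randomness for all words. -/
abbrev Sample : Type := Word → Noise

/-- The probability measure on the sample space, under which the randomness attached to different
words is independent. -/
def sampleLaw (δ : ℝ) (hδ : -1 < δ) : Measure Sample :=
  haveI : ∀ u, IsProbabilityMeasure (noiseLaw δ u) := isProbabilityMeasure_noiseLaw hδ
  Measure.infinitePi (noiseLaw δ)

/-- The uniform variable attached to the vertex `u`. -/
def unif (ω : Sample) (u : Word) : ℝ := (ω u).1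

/-- The Gamma variable attached to the vertex `u`. -/
def gam (ω : Sample) (u : Word) : ℝ := (ω u).2.1

/-- The `n`-th arrival time (counted from zero) of the unit-rate Poisson process attached to the
vertex `u`. -/
def arrival (ω : Sample) (u : Word) (n : ℕ) : ℝ := ∑ i ∈ Finset.range (n + 1), (ω u).2.2 i

/-- The intensity at the age `x` of the Poisson point process of the younger children of a vertex
with age `a` and Gamma variable `g`. -/
def intensity (δ a g x : ℝ) : ℝ :=
  g / (2 + δ) * (x ^ (-((1 + δ) / (2 + δ))) / a ^ (1 / (2 + δ)))

/-- The mass that the intensity puts on `[a, x]`. -/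
def cumIntensity (δ a g x : ℝ) : ℝ := ∫ t in a..x, intensity δ a g t

/-- The point at which the cumulative intensity reaches the level `s`. The images under this map
of the arrival times of a unit-rate Poisson process are, in increasing order, the points of a
Poisson point process on `[a, ∞)` with the given intensity; those arrival times that are at most
`cumIntensity δ a g 1` give the points in `[a, 1]`. -/
def youngAge (δ a g s : ℝ) : ℝ := sInf {x : ℝ | a ≤ x ∧ s ≤ cumIntensity δ a g x}

/-- The age of the vertex `u`. The root has a uniform age, an older child of `u` has the age
`U ^ ((2 + δ) / (1 + δ))` times the age of `u`, and the ages of the younger children of `u` are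
the ordered points of the Poisson point process of `u`. -/
def age (δ : ℝ) (ω : Sample) : Word → ℝ
  | [] => unif ω []
  | j :: u =>
    if j < numOld u then unif ω (j :: u) ^ ((2 + δ) / (1 + δ)) * age δ ω u
    else youngAge δ (age δ ω u) (gam ω u) (arrival ω u (j - numOld u))

/-- The number of children of label `y`: the number of points of the Poisson point process of `u`
in `[age of u, 1]`. -/
def numYoung (δ : ℝ) (ω : Sample) (u : Word) : ℕ :=
  Set.ncard {n : ℕ | arrival ω u n ≤ cumIntensity δ (age δ ω u) (gam ω u) 1}

/-- The number of children of `u`. The Pólya point tree consists of the words all of whose letters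
are smaller than the number of children of the vertex to which they are appended. -/
def numChildren (δ : ℝ) (ω : Sample) (u : Word) : ℕ := numOld u + numYoung δ ω u

/-- The friendship bias of the root of the rooted tree whose vertex `u` has `c u` children: the
average degree of the neighbours of the root minus the degree of the root, and zero if the root
has no neighbours. -/
def rootBias (c : Word → ℕ) : ℝ :=
  if c [] = 0 then 0
  else (∑ j ∈ Finset.range (c []), ((c [j] : ℝ) + 1)) / (c [] : ℝ) - (c [] : ℝ)

/-- The law `μ` of the friendship bias of the root of the Pólya point tree with parameter `δ`. -/
def biasLaw (δ : ℝ) (hδ : -1 < δ) : Measure ℝ :=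
  (sampleLaw δ hδ).map fun ω => rootBias (numChildren δ ω)

end PolyaPointTree

end

open scoped ENNReal

noncomputable section

namespace PolyaPointTree

/-! The exponent behind all bounds is 1+δ, contributed by the single older child of the root. With
root age a, uniform U and Gamma variable Γ of that child, its number of younger children is Poisson
with mean Γ(U^(-1/(1+δ)) a^(-1/(2+δ)) - 1), so a count of order x costs U of order x^(-(1+δ)). The
lower bounds claim exponents above 1+δ, the upper bounds exponents at most 1+δ.

Lower bound (`le_biasLaw`): with fixed positive probability the root has no younger child, and then
its bias is the number of children of the older child. Independently, U ≤ c x^(-(1+δ)), Γ > 1 and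
typical Poisson arrivals make that number at least x.

Upper bound (`biasLaw_le`): the bias is at most the degree of the older child plus the averaged
degrees of the younger ones. The first term has tail x^(-(1+δ)) (`sampleLaw_older_le`). A younger
child is at least as old in age value as the root, so given the root its p-th degree moment is at
most a constant times a^(-p/(2+δ)), which is integrable when p < 2+δ (`lintegral_young_le`). Jensen
and Markov with integer p = k+1 then give the tail x^(-(k+1)). -/

/-! ### Unit-rate Poisson process: tails and moments of the arrival count. -/

/-- The `n`-th partial sum (counted from zero) of a sequence of interarrival times. -/
def partialSum (t : ℕ → ℝ) (n : ℕ) : ℝ := ∑ i ∈ Finset.range (n + 1), t i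

/-- The number of arrivals up to time `l`. -/
def arrivalCount (t : ℕ → ℝ) (l : ℝ) : ℕ := Set.ncard {n : ℕ | partialSum t n ≤ l}

/-- The law of the interarrival times of a unit-rate Poisson process. -/
def interarrivalLaw : Measure (ℕ → ℝ) := Measure.infinitePi fun _ : ℕ => expMeasure 1

instance : IsProbabilityMeasure interarrivalLaw := by unfold interarrivalLaw; infer_instance

theorem measurable_partialSum (n : ℕ) : Measurable fun t : ℕ → ℝ => partialSum t n := by
  unfold partialSum; fun_prop

theorem measurable_arrivalCount : Measurable fun q : (ℕ → ℝ) × ℝ => arrivalCount q.1 q.2 := by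
  unfold arrivalCount
  refine measurable_ncard.comp ?_
  refine measurable_set_iff.2 fun n => ?_
  refine measurableSet_setOfPred.1 ?_
  exact measurableSet_le ((measurable_partialSum n).comp measurable_fst) measurable_snd

theorem gammaMeasure_ae_pos {a : ℝ} : ∀ᵐ x ∂gammaMeasure a 1, 0 < x := by
  have hm : Measurable (gammaPDF a 1) := (measurable_gammaPDFReal a 1).ennreal_ofReal
  rw [gammaMeasure, ae_withDensity_iff hm]
  have h : ∀ᵐ x : ℝ, x ≠ 0 := by simp [ae_iff]
  filter_upwards [h] with x hx hne
  by_contra hneg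
  exact hne (gammaPDF_of_neg (lt_of_le_of_ne (not_lt.1 hneg) hx))

theorem expMeasure_ae_pos : ∀ᵐ x ∂expMeasure 1, 0 < x := gammaMeasure_ae_pos

theorem ae_interarrival_nonneg : ∀ᵐ t ∂interarrivalLaw, ∀ i, 0 ≤ t i := by
  refine ae_all_iff.2 fun i => ?_
  have := (measurePreserving_eval_infinitePi (fun _ : ℕ => expMeasure 1) i).quasiMeasurePreserving.ae
    (expMeasure_ae_pos.mono fun x hx => hx.le)
  exact this

theorem lintegral_exp_neg_expMeasure :
    ∫⁻ x, ENNReal.ofReal (Real.exp (-x)) ∂expMeasure 1 = 2⁻¹ := by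
  have h1 : expMeasure 1 = volume.withDensity (exponentialPDF 1) := rfl
  have hm (r : ℝ) : Measurable (exponentialPDF r) :=
    (measurable_exponentialPDFReal r).ennreal_ofReal
  rw [h1, lintegral_withDensity_eq_lintegral_mul _ (hm 1) (by fun_prop)]
  have h2 : ∀ x : ℝ, (exponentialPDF 1 * fun x => ENNReal.ofReal (Real.exp (-x))) x
      = 2⁻¹ * exponentialPDF 2 x := by
    intro x
    have h3 : (2⁻¹ : ℝ≥0∞) = ENNReal.ofReal (2⁻¹) := by
      rw [ENNReal.ofReal_inv_of_pos two_pos]; simp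
    simp only [Pi.mul_apply, exponentialPDF_eq]
    split_ifs with h
    · rw [h3, ← ENNReal.ofReal_mul (by positivity), ← ENNReal.ofReal_mul (by positivity)]
      congr 1
      rw [one_mul, one_mul, ← Real.exp_add, ← mul_assoc]
      norm_num
      ring_nf
    · simp
  simp_rw [h2]
  rw [lintegral_const_mul _ (hm 2), lintegral_exponentialPDF_eq_one two_pos, mul_one]

theorem lintegral_exp_neg_partialSum (n : ℕ) :
    ∫⁻ t, ENNReal.ofReal (Real.exp (-partialSum t n)) ∂interarrivalLaw = 2⁻¹ ^ (n + 1) := by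
  have h1 : ∀ t : ℕ → ℝ, ENNReal.ofReal (Real.exp (-partialSum t n))
      = ∏ i ∈ Finset.range (n + 1), ENNReal.ofReal (Real.exp (-t i)) := by
    intro t
    rw [partialSum, ← Finset.sum_neg_distrib, Real.exp_sum,
      ENNReal.ofReal_prod_of_nonneg fun i _ => (Real.exp_pos _).le]
  have hind := iIndepFun_infinitePi (P := fun _ : ℕ => expMeasure 1)
    (X := fun _ x => ENNReal.ofReal (Real.exp (-x))) (fun _ => by fun_prop)
  have h2 (i : ℕ) : ∫⁻ t, ENNReal.ofReal (Real.exp (-t i)) ∂interarrivalLaw = 2⁻¹ := by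
    rw [← lintegral_exp_neg_expMeasure]
    exact (measurePreserving_eval_infinitePi (fun _ : ℕ => expMeasure 1) i).lintegral_comp
      (f := fun x => ENNReal.ofReal (Real.exp (-x))) (by fun_prop)
  simp_rw [h1]
  refine (lintegral_prod_eq_prod_lintegral_of_indepFun _ _ hind fun _ => by fun_prop).trans ?_
  exact (Finset.prod_congr rfl fun i _ => h2 i).trans (by simp)

/-- Chernoff bound with parameter 1: the probability is at most e^l 2^(-(n+1)), and e^(1/3) ≤ 3/2
absorbs e^l. -/
theorem interarrivalLaw_partialSum_le (n : ℕ) {l : ℝ} (hl : 3 * l ≤ n + 1) :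
    interarrivalLaw {t | partialSum t n ≤ l} ≤ ENNReal.ofReal ((3 / 4) ^ (n + 1)) := by
  have hexp : Real.exp (1 / 3) ≤ 3 / 2 := by
    have h := Real.exp_one_lt_d9
    have h3 : Real.exp (1 / 3) ^ 3 = Real.exp 1 := by
      rw [← Real.exp_nat_mul]; norm_num
    refine le_of_pow_le_pow_left₀ (n := 3) (by norm_num) (by norm_num) ?_
    rw [h3]; norm_num; linarith
  have hsub : {t | partialSum t n ≤ l} ⊆
      {t | ENNReal.ofReal (Real.exp (-l)) ≤ ENNReal.ofReal (Real.exp (-partialSum t n))} := by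
    intro t ht
    exact ENNReal.ofReal_le_ofReal (Real.exp_le_exp.2 (neg_le_neg ht))
  have hM := meas_ge_le_lintegral_div (μ := interarrivalLaw)
    (f := fun t => ENNReal.ofReal (Real.exp (-partialSum t n)))
    ((by have := measurable_partialSum n; fun_prop : Measurable fun t : ℕ → ℝ => ENNReal.ofReal (Real.exp (-partialSum t n))).aemeasurable)
    (ε := ENNReal.ofReal (Real.exp (-l))) (by simp [Real.exp_pos]) (by simp)
  refine (measure_mono hsub).trans (hM.trans ?_)
  rw [lintegral_exp_neg_partialSum]
  have h3 : (2⁻¹ : ℝ≥0∞) = ENNReal.ofReal (2⁻¹) := by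
    rw [ENNReal.ofReal_inv_of_pos two_pos]; simp
  rw [h3, ← ENNReal.ofReal_pow (by norm_num), ← ENNReal.ofReal_div_of_pos (Real.exp_pos _)]
  refine ENNReal.ofReal_le_ofReal ?_
  rw [Real.exp_neg, div_inv_eq_mul]
  have h4 : Real.exp l ≤ (3 / 2) ^ (n + 1) := by
    calc Real.exp l ≤ Real.exp (((n + 1 : ℕ) : ℝ) * (1 / 3)) := by
          apply Real.exp_le_exp.2; push_cast; linarith
      _ = Real.exp (1 / 3) ^ (n + 1) := Real.exp_nat_mul _ _
      _ ≤ _ := pow_le_pow_left₀ (Real.exp_pos _).le hexp _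
  calc (2⁻¹ : ℝ) ^ (n + 1) * Real.exp l ≤ 2⁻¹ ^ (n + 1) * (3 / 2) ^ (n + 1) := by gcongr
    _ = (3 / 4) ^ (n + 1) := by rw [← mul_pow]; norm_num

theorem tendsto_ofReal_geometric :
    Tendsto (fun n : ℕ => ENNReal.ofReal ((3 / 4 : ℝ) ^ (n + 1))) atTop (nhds 0) := by
  rw [← ENNReal.ofReal_zero]
  exact ENNReal.tendsto_ofReal ((tendsto_pow_atTop_nhds_zero_of_lt_one (by norm_num)
    (by norm_num)).comp (tendsto_add_atTop_nat 1))

/-- Needed because `Set.ncard` is 0 on infinite sets: the count is meaningful, and monotone in the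
time, only if finitely many arrivals occur before each time. -/
theorem ae_partialSum_unbounded :
    ∀ᵐ t ∂interarrivalLaw, ∀ K : ℕ, ∃ n, (K : ℝ) < partialSum t n := by
  refine ae_all_iff.2 fun K => ?_
  rw [ae_iff]
  refine le_antisymm (ge_of_tendsto tendsto_ofReal_geometric ?_) bot_le
  filter_upwards [eventually_ge_atTop (3 * K)] with n hn
  refine (measure_mono ?_).trans (interarrivalLaw_partialSum_le n (l := K) ?_)
  · intro t ht
    simp only [mem_ofPred_eq, not_exists, not_lt] at ht
    exact ht n
  · exact_mod_cast hn.trans (Nat.le_succ n)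

theorem partialSum_mono {t : ℕ → ℝ} (ht : ∀ i, 0 ≤ t i) : Monotone (partialSum t) := by
  intro m n h
  exact Finset.sum_le_sum_of_subset_of_nonneg (Finset.range_mono (by omega)) fun i _ _ => ht i

theorem finite_partialSum_le {t : ℕ → ℝ} (ht : ∀ i, 0 ≤ t i)
    (hu : ∀ K : ℕ, ∃ n, (K : ℝ) < partialSum t n) (l : ℝ) :
    {n : ℕ | partialSum t n ≤ l}.Finite := by
  obtain ⟨K, hK⟩ := exists_nat_ge l
  obtain ⟨n, hn⟩ := hu K
  refine (Set.finite_lt_nat n).subset fun m hm => ?_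
  by_contra hlt
  have := partialSum_mono ht (not_lt.1 hlt)
  simp only [mem_ofPred_eq] at hm
  linarith

theorem arrivalCount_mono {t : ℕ → ℝ} (ht : ∀ i, 0 ≤ t i)
    (hu : ∀ K : ℕ, ∃ n, (K : ℝ) < partialSum t n) : Monotone (arrivalCount t) := fun _ _ h =>
  Set.ncard_le_ncard (fun _ hn => le_trans hn h) (finite_partialSum_le ht hu _)

theorem partialSum_le_of_lt_arrivalCount {t : ℕ → ℝ} (ht : ∀ i, 0 ≤ t i) {l : ℝ} {m : ℕ}
    (h : m < arrivalCount t l) : partialSum t m ≤ l := by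
  by_contra hlt
  have hsub : {n : ℕ | partialSum t n ≤ l} ⊆ Finset.range m := by
    intro n hn
    simp only [Finset.coe_range, mem_Iio]
    by_contra hmn
    exact hlt ((partialSum_mono ht (not_lt.1 hmn)).trans hn)
  have := Set.ncard_le_ncard hsub (Finset.finite_toSet _)
  rw [Set.ncard_coe_finset, Finset.card_range] at this
  exact absurd h (not_lt.2 this)

theorem lt_arrivalCount_of_partialSum_le {t : ℕ → ℝ} (ht : ∀ i, 0 ≤ t i)
    (hu : ∀ K : ℕ, ∃ n, (K : ℝ) < partialSum t n) {l : ℝ} {m : ℕ} (h : partialSum t m ≤ l) :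
    m < arrivalCount t l := by
  have hsub : (Finset.range (m + 1) : Set ℕ) ⊆ {n : ℕ | partialSum t n ≤ l} := by
    intro n hn
    simp only [Finset.coe_range, mem_Iio] at hn
    exact (partialSum_mono ht (Nat.lt_succ_iff.1 hn)).trans h
  have := Set.ncard_le_ncard hsub (finite_partialSum_le ht hu l)
  rw [Set.ncard_coe_finset, Finset.card_range] at this
  exact this

theorem arrivalCount_eq_zero {t : ℕ → ℝ} (ht : ∀ i, 0 ≤ t i) {l : ℝ} (h : l < t 0) :
    arrivalCount t l = 0 := by
  by_contra hne
  have := partialSum_le_of_lt_arrivalCount ht (Nat.pos_of_ne_zero hne)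
  simp [partialSum] at this
  linarith

theorem summable_pow_mul_geometric (p : ℕ) :
    Summable fun m : ℕ => ((m : ℝ) + 2) ^ p * (3 / 4 : ℝ) ^ (m + 1) := by
  have h := summable_pow_mul_geometric_of_norm_lt_one p (r := (3 / 4 : ℝ)) (by norm_num)
  have h2 := ((summable_nat_add_iff 2).2 h).mul_left (4 / 3)
  refine h2.congr fun m => ?_
  push_cast
  rw [pow_succ _ (m + 1)]
  ring

/-- Counts up to 3l+1 contribute a multiple of (1+l)^p; larger counts lie in the range of the
geometric tail bound, whose total contribution is bounded uniformly in l. -/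
theorem lintegral_arrivalCount_pow_le (p : ℕ) :
    ∃ K : ℝ≥0∞, K ≠ ⊤ ∧ ∀ l : ℝ, 0 ≤ l →
      ∫⁻ t, ((arrivalCount t l : ℝ≥0∞) + 1) ^ p ∂interarrivalLaw
        ≤ K * ENNReal.ofReal (1 + l) ^ p := by
  set T : ℝ≥0∞ := ∑' m : ℕ, ENNReal.ofReal (((m : ℝ) + 2) ^ p * (3 / 4 : ℝ) ^ (m + 1)) with hT
  have hTtop : T ≠ ⊤ := (summable_pow_mul_geometric p).tsum_ofReal_ne_top
  refine ⟨3 ^ p + T, by finiteness, fun l hl => ?_⟩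
  have hpt : ∀ᵐ t ∂interarrivalLaw, ((arrivalCount t l : ℝ≥0∞) + 1) ^ p ≤
      ENNReal.ofReal (3 * (1 + l)) ^ p + ∑' m : ℕ, {t | 3 * l ≤ m + 1 ∧ partialSum t m ≤ l}.indicator
        (fun _ => ENNReal.ofReal (((m : ℝ) + 2) ^ p)) t := by
    filter_upwards [ae_interarrival_nonneg] with t ht
    have hcast (k : ℕ) : (k : ℝ≥0∞) + 1 = ENNReal.ofReal ((k : ℝ) + 1) := by
      rw [ENNReal.ofReal_add (by positivity) zero_le_one]; simp
    -- In the second case the count is m+1 with m > 3l, and the term of index m alone dominates.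
    by_cases h : (arrivalCount t l : ℝ) ≤ 3 * l + 1
    · refine le_add_right ?_
      rw [hcast]
      gcongr
      linarith
    · push Not at h
      obtain ⟨m, hm⟩ : ∃ m, arrivalCount t l = m + 1 := by
        refine Nat.exists_eq_succ_of_ne_zero fun h0 => ?_
        rw [h0] at h; norm_num at h; linarith
      refine le_add_left (le_trans ?_ (ENNReal.le_tsum m))
      rw [indicator_of_mem]
      · rw [hm, hcast, ENNReal.ofReal_pow (by positivity)]
        refine pow_le_pow_left' (ENNReal.ofReal_le_ofReal ?_) p
        push_cast; linarith
      · refine ⟨?_, partialSum_le_of_lt_arrivalCount ht (by omega)⟩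
        rw [hm] at h; push_cast at h; linarith
  refine (lintegral_mono_ae hpt).trans ?_
  have hmeas (m : ℕ) : MeasurableSet {t : ℕ → ℝ | 3 * l ≤ m + 1 ∧ partialSum t m ≤ l} :=
    (MeasurableSet.const _).inter (measurableSet_le (measurable_partialSum m) measurable_const)
  rw [lintegral_add_left measurable_const, lintegral_const, measure_univ, mul_one,
    lintegral_tsum fun m => (measurable_const.indicator (hmeas m)).aemeasurable, add_mul]
  refine add_le_add ?_ ?_
  · rw [ENNReal.ofReal_mul (by norm_num), mul_pow]; simp
  · refine le_trans ?_ (le_mul_of_one_le_right bot_le ?_)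
    · refine ENNReal.tsum_le_tsum fun m => ?_
      rw [lintegral_indicator_const (hmeas m), ENNReal.ofReal_mul (by positivity)]
      gcongr
      by_cases hlm : 3 * l ≤ m + 1
      · exact (measure_mono fun t ht => ht.2).trans (interarrivalLaw_partialSum_le m hlm)
      · simp [hlm]
    · refine one_le_pow₀ ?_
      rw [← ENNReal.ofReal_one]
      exact ENNReal.ofReal_le_ofReal (by linarith)

/-! ### Gamma moments, almost sure properties of the noise, and marginals. -/

theorem lintegral_rpow_gammaMeasure_ne_top {a q : ℝ} (ha : 0 < a) (hq : 0 ≤ q) :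
    ∫⁻ x, ENNReal.ofReal (x ^ q) ∂gammaMeasure a 1 ≠ ⊤ := by
  have hm : Measurable (gammaPDF a 1) := (measurable_gammaPDFReal a 1).ennreal_ofReal
  rw [gammaMeasure, lintegral_withDensity_eq_lintegral_mul _ hm (by fun_prop)]
  have h : ∀ᵐ x : ℝ, (gammaPDF a 1 * fun x => ENNReal.ofReal (x ^ q)) x
      = (Ioi (0 : ℝ)).indicator (fun x => ENNReal.ofReal
        ((Real.Gamma a)⁻¹ * (Real.exp (-x) * x ^ (a + q - 1)))) x := by
    have h0 : ∀ᵐ x : ℝ, x ≠ 0 := by simp [ae_iff]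
    filter_upwards [h0] with x hx
    rcases lt_or_gt_of_ne hx with h | h
    · rw [indicator_of_notMem (by simp [h.le]), Pi.mul_apply, gammaPDF_of_neg h, zero_mul]
    · rw [indicator_of_mem (by exact h), Pi.mul_apply, gammaPDF_of_nonneg h.le,
        ← ENNReal.ofReal_mul (by have := Real.Gamma_pos_of_pos ha; positivity)]
      congr 1
      rw [show a + q - 1 = (a - 1) + q by ring, Real.rpow_add h]
      simp
      ring
  rw [lintegral_congr_ae h, lintegral_indicator measurableSet_Ioi]
  have hint := (Real.GammaIntegral_convergent (s := a + q) (by linarith)).const_mul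
    (Real.Gamma a)⁻¹
  exact hint.lintegral_lt_top.ne

/-- The properties that the randomness attached to a vertex has almost surely. -/
structure GoodNoise (n : Noise) : Prop where
  unif_pos : 0 < n.1
  unif_le_one : n.1 ≤ 1
  gam_pos : 0 < n.2.1
  interarrival_nonneg : ∀ i, 0 ≤ n.2.2 i
  unbounded : ∀ K : ℕ, ∃ m, (K : ℝ) < partialSum n.2.2 m

theorem gammaShape_pos {δ : ℝ} (hδ : -1 < δ) (u : Word) : 0 < gammaShape δ u := by
  unfold gammaShape; split_ifs <;> linarith

theorem ae_goodNoise {δ : ℝ} (hδ : -1 < δ) (u : Word) : ∀ᵐ n ∂noiseLaw δ u, GoodNoise n := by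
  have hg := isProbabilityMeasure_gammaMeasure (gammaShape_pos hδ u) one_pos
  have hU : ∀ᵐ x ∂volume.restrict (Icc (0 : ℝ) 1), 0 < x ∧ x ≤ 1 := by
    have h0 : ∀ᵐ x : ℝ, x ≠ 0 := by simp [ae_iff]
    filter_upwards [ae_restrict_mem measurableSet_Icc, ae_restrict_of_ae h0] with x hx hx0
    exact ⟨lt_of_le_of_ne hx.1 hx0.symm, hx.2⟩
  have h1 := (Measure.quasiMeasurePreserving_fst (μ := volume.restrict (Icc (0 : ℝ) 1))
    (ν := (gammaMeasure (gammaShape δ u) 1).prod interarrivalLaw)).ae hU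
  have h2 := (Measure.quasiMeasurePreserving_snd (μ := volume.restrict (Icc (0 : ℝ) 1))
    (ν := (gammaMeasure (gammaShape δ u) 1).prod interarrivalLaw)).ae
    ((Measure.quasiMeasurePreserving_fst (μ := gammaMeasure (gammaShape δ u) 1)
    (ν := interarrivalLaw)).ae gammaMeasure_ae_pos)
  have h3 := (Measure.quasiMeasurePreserving_snd (μ := volume.restrict (Icc (0 : ℝ) 1))
    (ν := (gammaMeasure (gammaShape δ u) 1).prod interarrivalLaw)).ae
    ((Measure.quasiMeasurePreserving_snd (μ := gammaMeasure (gammaShape δ u) 1)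
    (ν := interarrivalLaw)).ae (ae_interarrival_nonneg.and ae_partialSum_unbounded))
  change ∀ᵐ n ∂(volume.restrict (Icc (0 : ℝ) 1)).prod
    ((gammaMeasure (gammaShape δ u) 1).prod interarrivalLaw), GoodNoise n
  filter_upwards [h1, h2, h3] with n h1 h2 h3
  exact ⟨h1.1, h1.2, h2, h3.1, h3.2⟩

section SampleLaw

variable {δ : ℝ} (hδ : -1 < δ)

theorem measurePreserving_eval_sampleLaw (u : Word) :
    MeasurePreserving (fun ω : Sample => ω u) (sampleLaw δ hδ) (noiseLaw δ u) :=
  have := isProbabilityMeasure_noiseLaw hδ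
  measurePreserving_eval_infinitePi (noiseLaw δ) u

theorem measurePreserving_eval_pair_sampleLaw {u w : Word} (h : u ≠ w) :
    MeasurePreserving (fun ω : Sample => (ω u, ω w)) (sampleLaw δ hδ)
      ((noiseLaw δ u).prod (noiseLaw δ w)) :=
  have := isProbabilityMeasure_noiseLaw hδ
  ⟨by fun_prop, Measure.infinitePi_map_eval_prod h⟩

theorem ae_good : ∀ᵐ ω ∂sampleLaw δ hδ, ∀ u, GoodNoise (ω u) :=
  ae_all_iff.2 fun u =>
    (measurePreserving_eval_sampleLaw hδ u).quasiMeasurePreserving.ae (ae_goodNoise hδ u)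

end SampleLaw

/-! ### Closed formulas for ages and numbers of younger children. -/

section Deterministic

variable {δ : ℝ}

theorem cumIntensity_eq (hδ : -1 < δ) {a x : ℝ} (g : ℝ) (ha : 0 < a) :
    cumIntensity δ a g x = g * (x ^ (1 / (2 + δ)) / a ^ (1 / (2 + δ)) - 1) := by
  have h2 : (0 : ℝ) < 2 + δ := by linarith
  have he : -((1 + δ) / (2 + δ)) + 1 = 1 / (2 + δ) := by field_simp; ring
  have hr : -1 < -((1 + δ) / (2 + δ)) := by
    have : 0 < 1 / (2 + δ) := by positivity
    linarith
  have hi : ∫ t in a..x, t ^ (-((1 + δ) / (2 + δ))) =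
      (x ^ (1 / (2 + δ)) - a ^ (1 / (2 + δ))) / (1 / (2 + δ)) := by
    rw [integral_rpow (Or.inl hr), he]
  have hpos : 0 < a ^ (1 / (2 + δ)) := Real.rpow_pos_of_pos ha _
  unfold cumIntensity intensity
  rw [intervalIntegral.integral_const_mul, intervalIntegral.integral_div, hi]
  field_simp

/-- Solves g((x/a)^(1/(2+δ)) - 1) = s for x; by monotonicity the infimum is attained there. -/
theorem youngAge_eq (hδ : -1 < δ) {a g s : ℝ} (ha : 0 < a) (hg : 0 < g) (hs : 0 ≤ s) :
    youngAge δ a g s = a * (1 + s / g) ^ (2 + δ) := by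
  have h2 : (0 : ℝ) < 2 + δ := by linarith
  have hb : 0 < 1 / (2 + δ) := by positivity
  have hpos : 0 < a ^ (1 / (2 + δ)) := Real.rpow_pos_of_pos ha _
  have hsg : 0 ≤ s / g := by positivity
  have hone : 1 ≤ (1 + s / g) ^ (2 + δ) := Real.one_le_rpow (by linarith) h2.le
  have hroot : (a * (1 + s / g) ^ (2 + δ)) ^ (1 / (2 + δ)) = a ^ (1 / (2 + δ)) * (1 + s / g) := by
    rw [Real.mul_rpow ha.le (by positivity), ← Real.rpow_mul (by positivity),
      mul_one_div_cancel h2.ne', Real.rpow_one]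
  have hle : a ≤ a * (1 + s / g) ^ (2 + δ) := le_mul_of_one_le_right ha.le hone
  refine IsLeast.csInf_eq ⟨⟨hle, ?_⟩, fun y hy => ?_⟩
  · rw [cumIntensity_eq hδ g ha, hroot]
    field_simp
    linarith
  · obtain ⟨hay, hsy⟩ := hy
    have hy0 : 0 < y := ha.trans_le hay
    rw [cumIntensity_eq hδ g ha] at hsy
    refine (Real.rpow_le_rpow_iff (by positivity) hy0.le hb).1 ?_
    rw [hroot]
    have h3 : s / g ≤ y ^ (1 / (2 + δ)) / a ^ (1 / (2 + δ)) - 1 := by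
      rw [div_le_iff₀ hg]; linarith
    have h4 : 1 + s / g ≤ y ^ (1 / (2 + δ)) / a ^ (1 / (2 + δ)) := by linarith
    rwa [le_div_iff₀ hpos, mul_comm] at h4

theorem arrival_nonneg {ω : Sample} (hω : ∀ u, GoodNoise (ω u)) (u : Word) (n : ℕ) :
    0 ≤ arrival ω u n := Finset.sum_nonneg fun i _ => (hω u).interarrival_nonneg i

theorem age_pos (hδ : -1 < δ) {ω : Sample} (hω : ∀ u, GoodNoise (ω u)) (u : Word) :
    0 < age δ ω u := by
  induction u with
  | nil => exact (hω []).unif_pos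
  | cons j u ih =>
    rw [age]
    split_ifs
    · exact mul_pos (Real.rpow_pos_of_pos (hω _).unif_pos _) ih
    · have hg : 0 < gam ω u := (hω u).gam_pos
      have hs := arrival_nonneg hω u (j - numOld u)
      rw [youngAge_eq hδ ih hg hs]
      positivity

theorem age_young (hδ : -1 < δ) {ω : Sample} (hω : ∀ u, GoodNoise (ω u)) {j : ℕ} {u : Word}
    (hj : ¬ j < numOld u) :
    age δ ω (j :: u) = age δ ω u * (1 + arrival ω u (j - numOld u) / gam ω u) ^ (2 + δ) := by
  have hg : 0 < gam ω u := (hω u).gam_pos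
  rw [age, if_neg hj, youngAge_eq hδ (age_pos hδ hω u) hg (arrival_nonneg hω u _)]

/-- The only information on the ages of younger children that the tail bounds use; it replaces their
dependent ages by that of the root. -/
theorem age_le_age_young (hδ : -1 < δ) {ω : Sample} (hω : ∀ u, GoodNoise (ω u)) {j : ℕ}
    {u : Word} (hj : ¬ j < numOld u) : age δ ω u ≤ age δ ω (j :: u) := by
  rw [age_young hδ hω hj]
  have hg : 0 < gam ω u := (hω u).gam_pos
  have hs : 0 ≤ arrival ω u (j - numOld u) / gam ω u := div_nonneg (arrival_nonneg hω u _) hg.le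
  exact le_mul_of_one_le_right (age_pos hδ hω u).le
    (Real.one_le_rpow (by linarith) (by linarith))

theorem numYoung_eq (hδ : -1 < δ) {ω : Sample} (hω : ∀ u, GoodNoise (ω u)) (u : Word) :
    numYoung δ ω u =
      arrivalCount (ω u).2.2 (gam ω u * (1 / age δ ω u ^ (1 / (2 + δ)) - 1)) := by
  unfold numYoung
  rw [cumIntensity_eq hδ _ (age_pos hδ hω u), Real.one_rpow]
  rfl

theorem numOld_nil : numOld [] = 1 := rfl

theorem label_singleton_zero : label [0] = some Label.o := by simp [label]

theorem label_singleton_succ (j : ℕ) : label [j + 1] = some Label.y := by simp [label]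

theorem numOld_singleton_zero : numOld [0] = 1 := by simp [numOld, label_singleton_zero]

theorem numOld_singleton_succ (j : ℕ) : numOld [j + 1] = 0 := by
  simp [numOld, label_singleton_succ]

theorem age_nil (ω : Sample) : age δ ω [] = unif ω [] := rfl

theorem age_singleton_zero (ω : Sample) :
    age δ ω [0] = unif ω [0] ^ ((2 + δ) / (1 + δ)) * unif ω [] := by
  simp [age, numOld_nil]

end Deterministic

/-! ### Measurability of the bias. -/

section Measurability

variable {δ : ℝ} (hδ : -1 < δ)

theorem measurable_unif (u : Word) : Measurable fun ω : Sample => unif ω u := by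
  unfold unif; fun_prop

theorem measurable_gam (u : Word) : Measurable fun ω : Sample => gam ω u := by
  unfold gam; fun_prop

theorem measurable_arrival (u : Word) (n : ℕ) : Measurable fun ω : Sample => arrival ω u n :=
  (measurable_partialSum n).comp (by fun_prop : Measurable fun ω : Sample => (ω u).2.2)

/-- Only almost everywhere, since the infimum in `youngAge` is replaced by its closed form, valid
for good noise. -/
theorem aemeasurable_age (u : Word) :
    AEMeasurable (fun ω => age δ ω u) (sampleLaw δ hδ) := by
  induction u with
  | nil => exact (measurable_unif []).aemeasurable
  | cons j u ih =>
    by_cases hj : j < numOld u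
    · simp only [age, if_pos hj]
      exact ((measurable_unif _).pow_const _).aemeasurable.mul ih
    · have h : (fun ω => age δ ω (j :: u)) =ᵐ[sampleLaw δ hδ] fun ω =>
          age δ ω u * (1 + arrival ω u (j - numOld u) / gam ω u) ^ (2 + δ) := by
        filter_upwards [ae_good hδ] with ω hω using age_young hδ hω hj
      refine AEMeasurable.congr (ih.mul ?_) h.symm
      exact ((((measurable_arrival u _).div (measurable_gam u)).const_add 1).pow_const
        (2 + δ)).aemeasurable

theorem aemeasurable_numChildren (u : Word) :
    AEMeasurable (fun ω => numChildren δ ω u) (sampleLaw δ hδ) := by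
  have h : (fun ω => numChildren δ ω u) =ᵐ[sampleLaw δ hδ] fun ω =>
      numOld u + arrivalCount (ω u).2.2 (gam ω u * (1 / age δ ω u ^ (1 / (2 + δ)) - 1)) := by
    filter_upwards [ae_good hδ] with ω hω
    rw [numChildren, numYoung_eq hδ hω]
  have hl : AEMeasurable (fun ω => gam ω u * (1 / age δ ω u ^ (1 / (2 + δ)) - 1))
      (sampleLaw δ hδ) :=
    (measurable_gam u).aemeasurable.mul
      ((((aemeasurable_age hδ u).pow_const _).const_div 1).sub_const 1)
  have ht : AEMeasurable (fun ω : Sample => (ω u).2.2) (sampleLaw δ hδ) :=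
    (by fun_prop : Measurable fun ω : Sample => (ω u).2.2).aemeasurable
  have hc := measurable_arrivalCount.comp_aemeasurable (ht.prodMk hl)
  have hadd := (measurable_of_countable fun k : ℕ => numOld u + k).comp_aemeasurable hc
  exact hadd.congr h.symm

theorem measurable_rootBias : Measurable rootBias := by
  -- Separating the root count from the other counts makes the length of the sum a countable
  -- parameter that can be fixed.
  have h : Measurable fun q : ℕ × (Word → ℕ) =>
      if q.1 = 0 then (0 : ℝ)
      else (∑ j ∈ Finset.range q.1, ((q.2 [j] : ℝ) + 1)) / (q.1 : ℝ) - (q.1 : ℝ) := by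
    refine measurable_from_prod_countable_right fun k => ?_
    by_cases hk : k = 0
    · simp only [hk, if_true]; exact measurable_const
    · simp only [if_neg hk]; fun_prop
  have hpair : Measurable fun c : Word → ℕ => (c [], c) :=
    (measurable_pi_apply []).prodMk measurable_id
  exact h.comp hpair

theorem aemeasurable_rootBias :
    AEMeasurable (fun ω => rootBias (numChildren δ ω)) (sampleLaw δ hδ) :=
  measurable_rootBias.comp_aemeasurable
    (aemeasurable_pi_lambda _ (aemeasurable_numChildren hδ))

theorem biasLaw_Ici (x : ℝ) :
    biasLaw δ hδ (Ici x) = sampleLaw δ hδ {ω | x ≤ rootBias (numChildren δ ω)} := by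
  rw [biasLaw, Measure.map_apply_of_aemeasurable (aemeasurable_rootBias hδ) measurableSet_Ici]
  rfl

end Measurability

/-! ### Upper bound: moments of the degrees of the younger children. -/

theorem lintegral_one_add_pow_gammaMeasure_ne_top {a : ℝ} (ha : 0 < a) (p : ℕ) :
    ∫⁻ g, ENNReal.ofReal (1 + g) ^ p ∂gammaMeasure a 1 ≠ ⊤ := by
  have := isProbabilityMeasure_gammaMeasure ha one_pos
  have hle : ∫⁻ g, ENNReal.ofReal (1 + g) ^ p ∂gammaMeasure a 1 ≤
      ∫⁻ g, ENNReal.ofReal (2 ^ (p - 1)) * (1 + ENNReal.ofReal (g ^ (p : ℝ)))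
        ∂gammaMeasure a 1 := by
    refine lintegral_mono_ae ?_
    filter_upwards [gammaMeasure_ae_pos] with g hg
    rw [← ENNReal.ofReal_one, ← ENNReal.ofReal_add zero_le_one (by positivity),
      ← ENNReal.ofReal_mul (by positivity), ← ENNReal.ofReal_pow (by positivity)]
    refine ENNReal.ofReal_le_ofReal ?_
    have h := add_pow_le zero_le_one hg.le p
    rwa [one_pow, ← Real.rpow_natCast g p] at h
  refine ne_top_of_le_ne_top ?_ hle
  rw [lintegral_const_mul _ (by fun_prop), lintegral_add_left measurable_const]
  have h := lintegral_rpow_gammaMeasure_ne_top ha (q := (p : ℝ)) (by positivity)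
  rw [lintegral_one, measure_univ]
  finiteness

theorem noiseLaw_eq (δ : ℝ) (u : Word) :
    noiseLaw δ u = (volume.restrict (Icc (0 : ℝ) 1)).prod
      ((gammaMeasure (gammaShape δ u) 1).prod interarrivalLaw) := rfl

instance : IsProbabilityMeasure (volume.restrict (Icc (0 : ℝ) 1)) := ⟨by simp⟩

theorem gammaShape_singleton_succ (δ : ℝ) (j : ℕ) : gammaShape δ [j + 1] = 1 + δ := by
  simp [gammaShape, label_singleton_succ]

theorem noiseLaw_singleton_succ (δ : ℝ) (j : ℕ) : noiseLaw δ [j + 1] = noiseLaw δ [1] := by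
  rw [noiseLaw_eq, noiseLaw_eq, gammaShape_singleton_succ, gammaShape_singleton_succ δ 0]

theorem measurable_arrivalCount_comp {α : Type*} [MeasurableSpace α] {t : α → ℕ → ℝ} {l : α → ℝ}
    (ht : Measurable t) (hl : Measurable l) : Measurable fun x => arrivalCount (t x) (l x) := by
  have hp : Measurable fun x => (t x, l x) := ht.prodMk hl
  have hc := measurable_arrivalCount.comp hp
  exact hc

theorem measurable_coe_arrivalCount_comp {α : Type*} [MeasurableSpace α] {t : α → ℕ → ℝ}
    {l : α → ℝ} (ht : Measurable t) (hl : Measurable l) :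
    Measurable fun x => (arrivalCount (t x) (l x) : ℝ≥0∞) := by
  have hc := (measurable_of_countable fun k : ℕ => (k : ℝ≥0∞)).comp
    (measurable_arrivalCount_comp ht hl)
  exact hc

theorem lintegral_noiseLaw_arrivalCount_pow_le {δ : ℝ} (hδ : -1 < δ) (u : Word) (p : ℕ) :
    ∃ K : ℝ≥0∞, K ≠ ⊤ ∧ ∀ c : ℝ, 1 ≤ c →
      ∫⁻ n, ((arrivalCount n.2.2 (n.2.1 * c) : ℝ≥0∞) + 1) ^ p ∂noiseLaw δ u
        ≤ K * ENNReal.ofReal c ^ p := by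
  obtain ⟨K, hK, hbound⟩ := lintegral_arrivalCount_pow_le p
  have hg := isProbabilityMeasure_gammaMeasure (gammaShape_pos hδ u) one_pos
  have hmom := lintegral_one_add_pow_gammaMeasure_ne_top (gammaShape_pos hδ u) p
  refine ⟨K * ∫⁻ g, ENNReal.ofReal (1 + g) ^ p ∂gammaMeasure (gammaShape δ u) 1,
    by finiteness, fun c hc => ?_⟩
  have hmeas : Measurable fun y : ℝ × (ℕ → ℝ) => ((arrivalCount y.2 (y.1 * c) : ℝ≥0∞) + 1) ^ p :=
    ((measurable_coe_arrivalCount_comp measurable_snd (measurable_fst.mul_const c)).add_const 1).pow_const p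
  rw [noiseLaw_eq]
  have hsnd := (measurePreserving_snd (μ := volume.restrict (Icc (0 : ℝ) 1))
    (ν := (gammaMeasure (gammaShape δ u) 1).prod interarrivalLaw)).lintegral_comp hmeas
  refine hsnd.trans_le ?_
  rw [lintegral_prod _ hmeas.aemeasurable]
  calc ∫⁻ g, ∫⁻ t, ((arrivalCount t (g * c) : ℝ≥0∞) + 1) ^ p ∂interarrivalLaw
          ∂gammaMeasure (gammaShape δ u) 1
      ≤ ∫⁻ g, (K * ENNReal.ofReal c ^ p) * ENNReal.ofReal (1 + g) ^ p
          ∂gammaMeasure (gammaShape δ u) 1 := by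
        refine lintegral_mono_ae ?_
        filter_upwards [gammaMeasure_ae_pos] with g hg
        -- As c ≥ 1, 1 + gc ≤ (1 + g)c, which separates g from c.
        refine (hbound (g * c) (by positivity)).trans ?_
        rw [mul_assoc, ← mul_pow, ← ENNReal.ofReal_mul (by linarith)]
        gcongr
        nlinarith
    _ = _ := by
        rw [lintegral_const_mul _ (by fun_prop)]
        ring

theorem setLIntegral_rpow_ne_top {r : ℝ} (hr : -1 < r) :
    ∫⁻ x in Icc (0 : ℝ) 1, ENNReal.ofReal (x ^ r) ≠ ⊤ := by
  have h := (intervalIntegral.intervalIntegrable_rpow' (a := 0) (b := 1) hr).1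
  rw [← restrict_Ioc_eq_restrict_Icc]
  exact h.lintegral_lt_top.ne

/-- The number of younger children of the root, as a function of the randomness attached to it. -/
def rootYoung (δ : ℝ) (n : Noise) : ℕ :=
  arrivalCount n.2.2 (n.2.1 * (1 / n.1 ^ (1 / (2 + δ)) - 1))

/-- The weight of the younger child of the root with index `j` in the average over the
neighbours. -/
def youngWeight (δ : ℝ) (j : ℕ) (n : Noise) : ℝ≥0∞ :=
  if j < rootYoung δ n then ((rootYoung δ n : ℝ≥0∞) + 1)⁻¹ else 0

theorem measurable_rootYoung (δ : ℝ) : Measurable (rootYoung δ) := by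
  have hl : Measurable fun n : Noise => n.2.1 * (1 / n.1 ^ (1 / (2 + δ)) - 1) := by fun_prop
  have ht : Measurable fun n : Noise => n.2.2 := by fun_prop
  exact measurable_arrivalCount_comp ht hl

theorem measurable_youngWeight (δ : ℝ) (j : ℕ) : Measurable (youngWeight δ j) :=
  (measurable_of_countable fun k : ℕ => if j < k then ((k : ℝ≥0∞) + 1)⁻¹ else 0).comp
    (measurable_rootYoung δ)

theorem tsum_youngWeight_le_one (δ : ℝ) (n : Noise) : ∑' j, youngWeight δ j n ≤ 1 := by
  rw [tsum_eq_sum (s := Finset.range (rootYoung δ n))]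
  · have h : ∀ j ∈ Finset.range (rootYoung δ n),
        youngWeight δ j n = ((rootYoung δ n : ℝ≥0∞) + 1)⁻¹ :=
      fun j hj => if_pos (Finset.mem_range.1 hj)
    rw [Finset.sum_congr rfl h, Finset.sum_const,
      Finset.card_range, nsmul_eq_mul, ← div_eq_mul_inv]
    exact ENNReal.div_le_of_le_mul (by simp)
  · intro j hj
    exact if_neg (by simpa using hj)

theorem numYoung_nil {δ : ℝ} (hδ : -1 < δ) {ω : Sample} (hω : ∀ u, GoodNoise (ω u)) :
    numYoung δ ω [] = rootYoung δ (ω []) := numYoung_eq hδ hω []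

/-- Conditionally on the root noise, the noise of each younger child is independent with one common
law, so every term has moment at most K a^(-p/(2+δ)). The weights sum to at most 1, and p < 2+δ
makes this power integrable at 0. -/
theorem lintegral_young_le {δ : ℝ} (hδ : -1 < δ) {p : ℕ} (hp : (p : ℝ) < 2 + δ) :
    ∫⁻ ω, ∑' j, youngWeight δ j (ω []) * ((numChildren δ ω [j + 1] : ℝ≥0∞) + 1) ^ p
      ∂sampleLaw δ hδ ≠ ⊤ := by
  have hprob := isProbabilityMeasure_noiseLaw hδ
  have h2 : (0 : ℝ) < 2 + δ := by linarith
  obtain ⟨K, hK, hbound⟩ := lintegral_noiseLaw_arrivalCount_pow_le hδ [1] p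
  set H : ℕ → Noise × Noise → ℝ≥0∞ := fun j q => youngWeight δ j q.1 *
    ((arrivalCount q.2.2.2 (q.2.2.1 * (1 / q.1.1 ^ (1 / (2 + δ)))) : ℝ≥0∞) + 1) ^ p with hH
  have hHm (j : ℕ) : Measurable (H j) := by
    have hl : Measurable fun q : Noise × Noise => q.2.2.1 * (1 / q.1.1 ^ (1 / (2 + δ))) := by
      fun_prop
    exact ((measurable_youngWeight δ j).comp measurable_fst).mul
      (((measurable_coe_arrivalCount_comp (by fun_prop) hl).add_const 1).pow_const p)
  have hle : ∀ᵐ ω ∂sampleLaw δ hδ,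
      ∑' j, youngWeight δ j (ω []) * ((numChildren δ ω [j + 1] : ℝ≥0∞) + 1) ^ p
        ≤ ∑' j, H j (ω [], ω [j + 1]) := by
    filter_upwards [ae_good hδ] with ω hω
    refine ENNReal.tsum_le_tsum fun j => ?_
    have hcount : numChildren δ ω [j + 1] ≤ arrivalCount (ω [j + 1]).2.2
        ((ω [j + 1]).2.1 * (1 / (ω []).1 ^ (1 / (2 + δ)))) := by
      rw [numChildren, numOld_singleton_succ, zero_add, numYoung_eq hδ hω]
      refine arrivalCount_mono (hω _).interarrival_nonneg (hω _).unbounded ?_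
      have hg : 0 < gam ω [j + 1] := (hω [j + 1]).gam_pos
      have ha : 0 < (ω []).1 := (hω []).unif_pos
      have hage : (ω []).1 ≤ age δ ω [j + 1] :=
        age_le_age_young hδ hω (u := []) (by simp [numOld_nil])
      have hpow : (ω []).1 ^ (1 / (2 + δ)) ≤ age δ ω [j + 1] ^ (1 / (2 + δ)) :=
        Real.rpow_le_rpow ha.le hage (by positivity)
      have hinv := one_div_le_one_div_of_le (Real.rpow_pos_of_pos ha _) hpow
      exact mul_le_mul_of_nonneg_left (by linarith) hg.le
    simp only [hH]
    gcongr
  refine ne_top_of_le_ne_top ?_ (lintegral_mono_ae hle)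
  have hterm (j : ℕ) : ∫⁻ ω, H j (ω [], ω [j + 1]) ∂sampleLaw δ hδ ≤
      ∫⁻ n, youngWeight δ j n * (K * ENNReal.ofReal (n.1 ^ (-(p / (2 + δ))))) ∂noiseLaw δ [] := by
    rw [(measurePreserving_eval_pair_sampleLaw hδ (by simp : ([] : Word) ≠ [j + 1])).lintegral_comp
      (hHm j), lintegral_prod _ (hHm j).aemeasurable]
    refine lintegral_mono_ae ?_
    filter_upwards [ae_goodNoise hδ []] with n hn
    simp only [hH]
    have hm : Measurable fun y : Noise =>
        ((arrivalCount y.2.2 (y.2.1 * (1 / n.1 ^ (1 / (2 + δ)))) : ℝ≥0∞) + 1) ^ p := by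
      have hl : Measurable fun y : Noise => y.2.1 * (1 / n.1 ^ (1 / (2 + δ))) := by fun_prop
      exact ((measurable_coe_arrivalCount_comp (by fun_prop) hl).add_const 1).pow_const p
    rw [lintegral_const_mul _ hm, noiseLaw_singleton_succ]
    have hpos := Real.rpow_pos_of_pos hn.unif_pos (1 / (2 + δ))
    have hone : 1 ≤ 1 / n.1 ^ (1 / (2 + δ)) := by
      rw [le_div_iff₀ hpos, one_mul]
      exact Real.rpow_le_one hn.unif_pos.le hn.unif_le_one (by positivity)
    refine mul_le_mul_right ((hbound _ hone).trans_eq ?_) _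
    rw [← ENNReal.ofReal_pow (by positivity)]
    congr 2
    rw [← Real.rpow_natCast, one_div, ← Real.rpow_neg hn.unif_pos.le,
      ← Real.rpow_mul hn.unif_pos.le]
    congr 1
    ring
  have hHc (j : ℕ) : Measurable fun ω : Sample => H j (ω [], ω [j + 1]) :=
    (hHm j).comp (by fun_prop : Measurable fun ω : Sample => (ω [], ω [j + 1]))
  rw [lintegral_tsum fun j => (hHc j).aemeasurable]
  refine ne_top_of_le_ne_top ?_ (ENNReal.tsum_le_tsum hterm)
  have hmr : Measurable fun n : Noise => K * ENNReal.ofReal (n.1 ^ (-((p : ℝ) / (2 + δ)))) := by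
    fun_prop
  have hwm (j : ℕ) : Measurable fun n : Noise =>
      youngWeight δ j n * (K * ENNReal.ofReal (n.1 ^ (-((p : ℝ) / (2 + δ))))) :=
    (measurable_youngWeight δ j).mul hmr
  rw [← lintegral_tsum fun j => (hwm j).aemeasurable]
  have hle2 : ∫⁻ n, ∑' j, youngWeight δ j n * (K * ENNReal.ofReal (n.1 ^ (-((p : ℝ) / (2 + δ)))))
      ∂noiseLaw δ [] ≤ ∫⁻ n, K * ENNReal.ofReal (n.1 ^ (-((p : ℝ) / (2 + δ)))) ∂noiseLaw δ [] := by
    refine lintegral_mono fun n => ?_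
    rw [ENNReal.tsum_mul_right]
    exact mul_le_of_le_one_left bot_le (tsum_youngWeight_le_one δ n)
  refine ne_top_of_le_ne_top ?_ hle2
  have hg := isProbabilityMeasure_gammaMeasure (gammaShape_pos hδ []) one_pos
  have hfst := (measurePreserving_fst (μ := volume.restrict (Icc (0 : ℝ) 1))
    (ν := (gammaMeasure (gammaShape δ []) 1).prod interarrivalLaw)).lintegral_comp
    (f := fun x => K * ENNReal.ofReal (x ^ (-((p : ℝ) / (2 + δ))))) (by fun_prop)
  rw [noiseLaw_eq, hfst, lintegral_const_mul _ (by fun_prop)]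
  have hexp : -1 < -((p : ℝ) / (2 + δ)) := by
    rw [neg_lt_neg_iff, div_lt_one h2]; exact hp
  have := setLIntegral_rpow_ne_top hexp
  finiteness

theorem sum_range_pow_le (N : ℕ) (f : ℕ → ℝ) (hf : ∀ j, 0 ≤ f j) (k : ℕ) :
    (∑ j ∈ Finset.range N, f j) ^ (k + 1) ≤
      ((N : ℝ) + 1) ^ k * ∑ j ∈ Finset.range N, f j ^ (k + 1) := by
  rcases Nat.eq_zero_or_pos N with rfl | hN
  · simp
  have h := pow_sum_div_card_le_sum_pow (s := Finset.range N) (fun i _ => hf i) k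
  rw [Finset.card_range, div_le_iff₀' (by positivity)] at h
  refine h.trans ?_
  have hs : 0 ≤ ∑ j ∈ Finset.range N, f j ^ (k + 1) :=
    Finset.sum_nonneg fun i _ => pow_nonneg (hf i) _
  gcongr
  linarith

/-- Jensen's inequality for the weights 1/(Y+1), Y being the number of younger children; their total
mass is at most 1. -/
theorem ofReal_pow_le_tsum_youngWeight {δ : ℝ} (hδ : -1 < δ) {ω : Sample}
    (hω : ∀ u, GoodNoise (ω u)) {s : ℝ} (hs : 0 ≤ s) (k : ℕ)
    (h : s ≤ (∑ j ∈ Finset.range (numYoung δ ω []), ((numChildren δ ω [j + 1] : ℝ) + 1)) /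
      ((numYoung δ ω [] : ℝ) + 1)) :
    ENNReal.ofReal s ^ (k + 1) ≤
      ∑' j, youngWeight δ j (ω []) * ((numChildren δ ω [j + 1] : ℝ≥0∞) + 1) ^ (k + 1) := by
  set Y := numYoung δ ω [] with hY
  have hY' : rootYoung δ (ω []) = Y := (numYoung_nil hδ hω).symm
  set D : ℕ → ℝ := fun j => (numChildren δ ω [j + 1] : ℝ) + 1 with hD
  have hD0 (j : ℕ) : 0 ≤ D j := by positivity
  have hY0 : (0 : ℝ) < (Y : ℝ) + 1 := by positivity
  have hreal : s ^ (k + 1) ≤ ∑ j ∈ Finset.range Y, ((Y : ℝ) + 1)⁻¹ * D j ^ (k + 1) := by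
    rw [← Finset.mul_sum, inv_mul_eq_div, le_div_iff₀ hY0]
    rw [le_div_iff₀ hY0] at h
    have h1 : (s * (Y + 1)) ^ (k + 1) ≤ (∑ j ∈ Finset.range Y, D j) ^ (k + 1) :=
      pow_le_pow_left₀ (by positivity) h _
    have h3 := sum_range_pow_le Y D hD0 k
    have h4 : ((Y : ℝ) + 1) ^ k * (s ^ (k + 1) * (Y + 1)) ≤
        ((Y : ℝ) + 1) ^ k * ∑ j ∈ Finset.range Y, D j ^ (k + 1) := by
      calc _ = (s * (Y + 1)) ^ (k + 1) := by rw [mul_pow]; ring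
        _ ≤ _ := h1.trans h3
    exact le_of_mul_le_mul_left h4 (by positivity)
  have hcast (j : ℕ) (hj : j ∈ Finset.range Y) :
      ENNReal.ofReal (((Y : ℝ) + 1)⁻¹ * D j ^ (k + 1)) =
        youngWeight δ j (ω []) * ((numChildren δ ω [j + 1] : ℝ≥0∞) + 1) ^ (k + 1) := by
    have hc (m : ℕ) : ENNReal.ofReal ((m : ℝ) + 1) = (m : ℝ≥0∞) + 1 := by
      rw [ENNReal.ofReal_add (by positivity) zero_le_one]; simp
    rw [youngWeight, hY', if_pos (Finset.mem_range.1 hj), ENNReal.ofReal_mul (by positivity),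
      ENNReal.ofReal_inv_of_pos hY0, hc, ENNReal.ofReal_pow (hD0 j), hc]
  rw [← ENNReal.ofReal_pow hs]
  refine (ENNReal.ofReal_le_ofReal hreal).trans ?_
  rw [ENNReal.ofReal_sum_of_nonneg fun j _ => by have := hD0 j; positivity,
    Finset.sum_congr rfl hcast]
  exact ENNReal.sum_le_tsum _

/-! ### Upper bound: tail of the degree of the older child. -/

theorem restrict_Icc_setOf_le_le (r : ℝ) :
    volume.restrict (Icc (0 : ℝ) 1) {u | u ≤ r} ≤ ENNReal.ofReal r := by
  change volume.restrict (Icc (0 : ℝ) 1) (Iic r) ≤ ENNReal.ofReal r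
  rw [Measure.restrict_apply measurableSet_Iic]
  calc volume (Iic r ∩ Icc (0 : ℝ) 1) ≤ volume (Icc (0 : ℝ) r) :=
        measure_mono fun u hu => ⟨hu.2.1, hu.1⟩
    _ = ENNReal.ofReal r := by simp

/-- Integrating the uniform variable first gives at most c Γ^(1+δ) a^(-(1+δ)/(2+δ)); both factors
have finite mean, as (1+δ)/(2+δ) < 1. -/
theorem sampleLaw_unif_le {δ : ℝ} (hδ : -1 < δ) :
    ∃ M : ℝ≥0∞, M ≠ ⊤ ∧ ∀ c : ℝ, 0 ≤ c →
      sampleLaw δ hδ {ω | unif ω [0] ≤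
        c * (gam ω [0] ^ (1 + δ) * unif ω [] ^ (-((1 + δ) / (2 + δ))))} ≤ M * ENNReal.ofReal c := by
  have hprob := isProbabilityMeasure_noiseLaw hδ
  have hg := isProbabilityMeasure_gammaMeasure (gammaShape_pos hδ [0]) one_pos
  have hg' := isProbabilityMeasure_gammaMeasure (gammaShape_pos hδ []) one_pos
  have h1 : (0 : ℝ) < 1 + δ := by linarith
  have h2 : (0 : ℝ) < 2 + δ := by linarith
  set G := ∫⁻ g, ENNReal.ofReal (g ^ (1 + δ)) ∂gammaMeasure (gammaShape δ [0]) 1 with hG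
  set A := ∫⁻ x in Icc (0 : ℝ) 1, ENNReal.ofReal (x ^ (-((1 + δ) / (2 + δ)))) with hA
  have hGtop : G ≠ ⊤ := lintegral_rpow_gammaMeasure_ne_top (gammaShape_pos hδ [0]) h1.le
  have hAtop : A ≠ ⊤ := by
    refine setLIntegral_rpow_ne_top ?_
    rw [neg_lt_neg_iff, div_lt_one h2]
    linarith
  refine ⟨G * A, by finiteness, fun c hc => ?_⟩
  set S : Set (Noise × Noise) := {q | q.2.1 ≤
    c * (q.2.2.1 ^ (1 + δ) * q.1.1 ^ (-((1 + δ) / (2 + δ))))} with hS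
  have hSm : MeasurableSet S := measurableSet_le (by fun_prop) (by fun_prop)
  have hmp := measurePreserving_eval_pair_sampleLaw hδ (by simp : ([] : Word) ≠ [0])
  change sampleLaw δ hδ ((fun ω : Sample => (ω [], ω [0])) ⁻¹' S) ≤ _
  rw [hmp.measure_preimage hSm.nullMeasurableSet, Measure.prod_apply hSm]
  have hinner : ∀ᵐ n ∂noiseLaw δ [], noiseLaw δ [0] (Prod.mk n ⁻¹' S) ≤
      ENNReal.ofReal c * G * ENNReal.ofReal (n.1 ^ (-((1 + δ) / (2 + δ)))) := by
    filter_upwards [ae_goodNoise hδ []] with n hn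
    have hn0 := Real.rpow_nonneg hn.unif_pos.le (-((1 + δ) / (2 + δ)))
    have hTm : MeasurableSet (Prod.mk n ⁻¹' S) := measurable_prodMk_left hSm
    rw [noiseLaw_eq, Measure.prod_apply_symm hTm]
    calc ∫⁻ y, volume.restrict (Icc (0 : ℝ) 1) ((fun u => (u, y)) ⁻¹' (Prod.mk n ⁻¹' S))
            ∂(gammaMeasure (gammaShape δ [0]) 1).prod interarrivalLaw
        ≤ ∫⁻ y, ENNReal.ofReal (c * n.1 ^ (-((1 + δ) / (2 + δ)))) * ENNReal.ofReal (y.1 ^ (1 + δ))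
            ∂(gammaMeasure (gammaShape δ [0]) 1).prod interarrivalLaw := by
          refine lintegral_mono fun y => ?_
          rw [← ENNReal.ofReal_mul (by positivity)]
          refine (restrict_Icc_setOf_le_le
            (c * (y.1 ^ (1 + δ) * n.1 ^ (-((1 + δ) / (2 + δ)))))).trans_eq ?_
          congr 1
          ring
      _ = ENNReal.ofReal (c * n.1 ^ (-((1 + δ) / (2 + δ)))) * G := by
          rw [lintegral_const_mul _ (by fun_prop)]
          congr 1
          exact (measurePreserving_fst (μ := gammaMeasure (gammaShape δ [0]) 1)
            (ν := interarrivalLaw)).lintegral_comp (f := fun x => ENNReal.ofReal (x ^ (1 + δ)))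
            (by fun_prop)
      _ = _ := by rw [ENNReal.ofReal_mul hc]; ring
  refine (lintegral_mono_ae hinner).trans_eq ?_
  rw [lintegral_const_mul _ (by fun_prop)]
  have hfst := (measurePreserving_fst (μ := volume.restrict (Icc (0 : ℝ) 1))
    (ν := (gammaMeasure (gammaShape δ []) 1).prod interarrivalLaw)).lintegral_comp
    (f := fun x => ENNReal.ofReal (x ^ (-((1 + δ) / (2 + δ))))) (by fun_prop)
  rw [noiseLaw_eq, hfst]
  ring

theorem age_singleton_zero_rpow {δ : ℝ} (hδ : -1 < δ) {ω : Sample} (hω : ∀ u, GoodNoise (ω u)) :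
    age δ ω [0] ^ (1 / (2 + δ)) =
      unif ω [0] ^ (1 / (1 + δ)) * unif ω [] ^ (1 / (2 + δ)) := by
  have h1 : (0 : ℝ) < 1 + δ := by linarith
  have h2 : (0 : ℝ) < 2 + δ := by linarith
  have hU : 0 < unif ω [0] := (hω [0]).unif_pos
  have ha : 0 < unif ω [] := (hω []).unif_pos
  rw [age_singleton_zero, Real.mul_rpow (by positivity) ha.le, ← Real.rpow_mul hU.le]
  congr 2
  field_simp

/-- Arrival m occurs before the total intensity, which is below Γ/(U^(1/(1+δ)) a^(1/(2+δ))). If the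
arrival is later than y, this quotient exceeds y; solving for U gives the second alternative. -/
theorem partialSum_le_or_unif_le {δ : ℝ} (hδ : -1 < δ) {ω : Sample} (hω : ∀ u, GoodNoise (ω u))
    {y : ℝ} (hy : 0 < y) {m : ℕ} (hm : m < numYoung δ ω [0]) :
    partialSum (ω [0]).2.2 m ≤ y ∨ unif ω [0] ≤
      (1 / y) ^ (1 + δ) * (gam ω [0] ^ (1 + δ) * unif ω [] ^ (-((1 + δ) / (2 + δ)))) := by
  have h1 : (0 : ℝ) < 1 + δ := by linarith
  have h2 : (0 : ℝ) < 2 + δ := by linarith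
  have hU : 0 < unif ω [0] := (hω [0]).unif_pos
  have ha : 0 < unif ω [] := (hω []).unif_pos
  have hg : 0 < gam ω [0] := (hω [0]).gam_pos
  rw [numYoung_eq hδ hω, age_singleton_zero_rpow hδ hω] at hm
  have hsum := partialSum_le_of_lt_arrivalCount (hω [0]).interarrival_nonneg hm
  refine or_iff_not_imp_left.2 fun hlt => ?_
  push Not at hlt
  have ha' : 0 < unif ω [] ^ (1 / (2 + δ)) := Real.rpow_pos_of_pos ha _
  have hU' : 0 < unif ω [0] ^ (1 / (1 + δ)) := Real.rpow_pos_of_pos hU _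
  have h3 : y < gam ω [0] * (1 / (unif ω [0] ^ (1 / (1 + δ)) * unif ω [] ^ (1 / (2 + δ)))) := by
    linarith
  rw [mul_one_div, lt_div_iff₀ (by positivity)] at h3
  have h4 : unif ω [0] ^ (1 / (1 + δ)) ≤ 1 / y * (gam ω [0] * (unif ω [] ^ (1 / (2 + δ)))⁻¹) := by
    rw [← mul_assoc, ← div_eq_mul_inv, le_div_iff₀ ha', one_div_mul_eq_div, le_div_iff₀ hy]
    linarith
  have h5 := Real.rpow_le_rpow hU'.le h4 h1.le
  rw [← Real.rpow_mul hU.le, one_div_mul_cancel h1.ne', Real.rpow_one,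
    Real.mul_rpow (by positivity) (by positivity), Real.mul_rpow hg.le (by positivity),
    ← Real.rpow_neg ha.le, ← Real.rpow_mul ha.le] at h5
  convert h5 using 4
  ring

theorem eventually_exp_neg_le_rpow_neg (q : ℝ) :
    ∀ᶠ x : ℝ in atTop, Real.exp (-(1 / 16 * x)) ≤ x ^ (-q) := by
  have h := tendsto_rpow_mul_exp_neg_mul_atTop_nhds_zero q (1 / 16) (by norm_num)
  filter_upwards [h.eventually (eventually_le_nhds one_pos), eventually_gt_atTop 0] with x hx hx0
  rw [Real.rpow_neg hx0.le, ← one_div, le_div_iff₀ (Real.rpow_pos_of_pos hx0 _), mul_comm]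
  rwa [neg_mul] at hx

theorem sampleLaw_older_le {δ : ℝ} (hδ : -1 < δ) :
    ∃ C : ℝ≥0∞, C ≠ ⊤ ∧ ∀ᶠ x : ℝ in atTop,
      sampleLaw δ hδ {ω | x / 2 ≤ (numChildren δ ω [0] : ℝ) + 1} ≤
        C * ENNReal.ofReal (x ^ (-(1 + δ))) := by
  obtain ⟨M, hM, hbound⟩ := sampleLaw_unif_le hδ
  refine ⟨1 + M * ENNReal.ofReal (12 ^ (1 + δ)), by finiteness, ?_⟩
  -- For x ≥ 8, a degree of at least x/2, which is the number of younger children plus 2, leaves at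
  -- least x/4 younger children.
  filter_upwards [eventually_exp_neg_le_rpow_neg (1 + δ), eventually_ge_atTop 8] with x hexp hx
  have hx0 : 0 < x := by linarith
  obtain ⟨m, hm⟩ : ∃ m, ⌈x / 4⌉₊ = m + 1 :=
    Nat.exists_eq_succ_of_ne_zero (Nat.ceil_pos.2 (by positivity)).ne'
  have hxm : x / 4 ≤ m + 1 := by
    have := Nat.le_ceil (x / 4)
    rw [hm] at this
    exact_mod_cast this
  -- The level x/12 is a third of x/4 ≤ m+1, as the Chernoff bound requires; the resulting
  -- (3/4)^(m+1) ≤ e^(-(m+1)/4) is at most e^(-x/16).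
  set B : Set (ℕ → ℝ) := {t | partialSum t m ≤ x / 12} with hB
  have hBm : MeasurableSet B := measurableSet_le (measurable_partialSum m) measurable_const
  have hsub : ∀ᵐ ω ∂sampleLaw δ hδ, ω ∈ {ω | x / 2 ≤ (numChildren δ ω [0] : ℝ) + 1} →
      ω ∈ {ω : Sample | (ω [0]).2.2 ∈ B} ∪ {ω | unif ω [0] ≤
        (1 / (x / 12)) ^ (1 + δ) * (gam ω [0] ^ (1 + δ) * unif ω [] ^ (-((1 + δ) / (2 + δ))))} := by
    filter_upwards [ae_good hδ] with ω hω h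
    rw [numChildren, numOld_singleton_zero] at h
    push_cast at h
    have hlt : m < numYoung δ ω [0] := by
      have : ⌈x / 4⌉₊ ≤ numYoung δ ω [0] := Nat.ceil_le.2 (by linarith)
      omega
    exact partialSum_le_or_unif_le hδ hω (by positivity) hlt
  refine (measure_mono_ae hsub).trans ((measure_union_le _ _).trans ?_)
  rw [add_mul]
  refine add_le_add ?_ ?_
  · have hprob := isProbabilityMeasure_gammaMeasure (gammaShape_pos hδ [0]) one_pos
    have hmp : MeasurePreserving (fun ω : Sample => (ω [0]).2.2) (sampleLaw δ hδ)
        interarrivalLaw :=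
      (measurePreserving_snd.comp measurePreserving_snd).comp
        (measurePreserving_eval_sampleLaw hδ [0])
    have hpre := hmp.measure_preimage hBm.nullMeasurableSet
    refine hpre.trans_le ((interarrivalLaw_partialSum_le m (by linarith)).trans ?_)
    rw [one_mul]
    refine ENNReal.ofReal_le_ofReal (le_trans ?_ hexp)
    have h34 : (3 / 4 : ℝ) ≤ Real.exp (-(1 / 4)) := by
      have := Real.add_one_le_exp (-(1 / 4) : ℝ)
      linarith
    calc (3 / 4 : ℝ) ^ (m + 1) ≤ Real.exp (-(1 / 4)) ^ (m + 1) := by gcongr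
      _ = Real.exp (((m + 1 : ℕ) : ℝ) * (-(1 / 4))) := (Real.exp_nat_mul _ _).symm
      _ ≤ _ := by
        apply Real.exp_le_exp.2
        push_cast
        linarith
  · refine (hbound _ (by positivity)).trans_eq ?_
    rw [mul_assoc, ← ENNReal.ofReal_mul (by positivity)]
    congr 2
    rw [one_div_div, Real.div_rpow (by norm_num) hx0.le, Real.rpow_neg hx0.le, div_eq_mul_inv]

/-! ### Upper bound: combining the two contributions. -/

theorem rootBias_le_cases {δ : ℝ} {ω : Sample} {x : ℝ} (hx : x ≤ rootBias (numChildren δ ω)) :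
    x / 2 ≤ (numChildren δ ω [0] : ℝ) + 1 ∨
      x / 2 ≤ (∑ j ∈ Finset.range (numYoung δ ω []), ((numChildren δ ω [j + 1] : ℝ) + 1)) /
        ((numYoung δ ω [] : ℝ) + 1) := by
  have hc : numChildren δ ω [] = numYoung δ ω [] + 1 := by
    rw [numChildren, numOld_nil, add_comm]
  rw [rootBias, if_neg (by omega), hc, Finset.sum_range_succ'] at hx
  push_cast at hx
  set Y : ℝ := (numYoung δ ω [] : ℝ) with hY
  have hY0 : 0 ≤ Y := by positivity
  rw [add_div] at hx
  have hold : ((numChildren δ ω [0] : ℝ) + 1) / (Y + 1) ≤ (numChildren δ ω [0] : ℝ) + 1 :=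
    div_le_self (by positivity) (by linarith)
  by_contra! h
  linarith [h.1, h.2]

/-- The older child limits r to 1+δ, Markov's inequality for the moment of order k+1 limits it to
k+1. -/
theorem biasLaw_le {δ : ℝ} (hδ : -1 < δ) {k : ℕ} (hk : (k : ℝ) + 1 < 2 + δ) {r : ℝ}
    (hrk : r ≤ k + 1) (hrδ : r ≤ 1 + δ) :
    ∃ C : ℝ≥0∞, C ≠ ⊤ ∧ ∀ᶠ x : ℝ in atTop,
      biasLaw δ hδ (Ici x) ≤ C * ENNReal.ofReal (x ^ (-r)) := by
  obtain ⟨C, hC, hold⟩ := sampleLaw_older_le hδ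
  set F : Sample → ℝ≥0∞ := fun ω =>
    ∑' j, youngWeight δ j (ω []) * ((numChildren δ ω [j + 1] : ℝ≥0∞) + 1) ^ (k + 1) with hF
  have hFtop : ∫⁻ ω, F ω ∂sampleLaw δ hδ ≠ ⊤ :=
    lintegral_young_le hδ (by push_cast; exact hk)
  have hFm : AEMeasurable F (sampleLaw δ hδ) := by
    refine AEMeasurable.tsum fun j => AEMeasurable.mul ?_ ?_
    · exact ((measurable_youngWeight δ j).comp (measurable_pi_apply [])).aemeasurable
    · have hc := (measurable_of_countable fun i : ℕ => ((i : ℝ≥0∞) + 1) ^ (k + 1)).comp_aemeasurable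
        (aemeasurable_numChildren hδ [j + 1])
      exact hc
  set E := ∫⁻ ω, F ω ∂sampleLaw δ hδ with hE
  refine ⟨C + E * ENNReal.ofReal (2 ^ (k + 1)), by finiteness, ?_⟩
  filter_upwards [hold, eventually_ge_atTop 1] with x hx hx1
  have hx0 : 0 < x := by linarith
  have hsub : ∀ᵐ ω ∂sampleLaw δ hδ, ω ∈ {ω | x ≤ rootBias (numChildren δ ω)} →
      ω ∈ {ω | x / 2 ≤ (numChildren δ ω [0] : ℝ) + 1} ∪
        {ω | ENNReal.ofReal (x / 2) ^ (k + 1) ≤ F ω} := by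
    filter_upwards [ae_good hδ] with ω hω h
    exact (rootBias_le_cases h).imp id
      (ofReal_pow_le_tsum_youngWeight hδ hω (by positivity) k)
  rw [biasLaw_Ici]
  refine (measure_mono_ae hsub).trans ((measure_union_le _ _).trans ?_)
  rw [add_mul]
  have hmono {s : ℝ} (hs : r ≤ s) : ENNReal.ofReal (x ^ (-s)) ≤ ENNReal.ofReal (x ^ (-r)) :=
    ENNReal.ofReal_le_ofReal (Real.rpow_le_rpow_of_exponent_le hx1 (by linarith))
  refine add_le_add (hx.trans (mul_le_mul_right (hmono hrδ) C)) ?_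
  have hpos : 0 < ENNReal.ofReal (x / 2) ^ (k + 1) :=
    ENNReal.pow_pos (ENNReal.ofReal_pos.2 (by positivity)) _
  refine (meas_ge_le_lintegral_div hFm hpos.ne' (by finiteness)).trans ?_
  rw [mul_assoc, ENNReal.div_eq_inv_mul, mul_comm]
  refine mul_le_mul_right (le_trans (le_of_eq ?_) (mul_le_mul_right (hmono hrk) _)) E
  rw [← ENNReal.ofReal_pow (by positivity), ← ENNReal.ofReal_inv_of_pos (by positivity),
    ← ENNReal.ofReal_mul (by positivity)]
  congr 1
  have hcast : ((k : ℝ) + 1) = ((k + 1 : ℕ) : ℝ) := by push_cast; rfl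
  rw [hcast, Real.rpow_neg hx0.le, Real.rpow_natCast, div_pow, inv_div, div_eq_mul_inv]

theorem limsup_lt_top_of_eventually_le {f : ℝ → ℝ≥0∞} {r : ℝ} {C : ℝ≥0∞} (hC : C ≠ ⊤)
    (h : ∀ᶠ x : ℝ in atTop, f x ≤ C * ENNReal.ofReal (x ^ (-r))) :
    limsup (fun x : ℝ => f x / ENNReal.ofReal (x ^ (-r))) atTop < ⊤ := by
  refine lt_of_le_of_lt (limsup_le_of_le (by isBoundedDefault) ?_) hC.lt_top
  filter_upwards [h] with x hx using ENNReal.div_le_of_le_mul hx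

/-! ### Lower bound: a root with only its older child. -/

theorem gammaMeasure_ne_zero {a : ℝ} (ha : 0 < a) {S : Set ℝ} (hS : S ⊆ Ioi 0)
    (hvol : volume S ≠ 0) : gammaMeasure a 1 S ≠ 0 := by
  have hm : Measurable (gammaPDF a 1) := (measurable_gammaPDFReal a 1).ennreal_ofReal
  rw [gammaMeasure, Ne, withDensity_apply_eq_zero hm]
  convert hvol using 2
  refine congrArg volume (inter_eq_right.2 fun x hx => ?_)
  exact (ENNReal.ofReal_pos.2 (gammaPDFReal_pos ha one_pos (hS hx))).ne'

theorem gammaMeasure_Ioi_one_ne_zero {a : ℝ} (ha : 0 < a) : gammaMeasure a 1 (Ioi 1) ≠ 0 :=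
  gammaMeasure_ne_zero ha (Ioi_subset_Ioi zero_le_one) (by simp)

theorem gammaMeasure_Iic_one_ne_zero {a : ℝ} (ha : 0 < a) : gammaMeasure a 1 (Iic 1) ≠ 0 := by
  have h : gammaMeasure a 1 (Ioc 0 1) ≠ 0 :=
    gammaMeasure_ne_zero ha (fun _ hx => hx.1) (by simp)
  exact fun h0 => h (measure_mono_null Ioc_subset_Iic_self h0)

theorem lintegral_partialSum_le (m : ℕ) :
    ∫⁻ t, ENNReal.ofReal (partialSum t m) ∂interarrivalLaw ≤
      (m + 1) * ∫⁻ x, ENNReal.ofReal x ∂expMeasure 1 := by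
  have h1 : ∀ᵐ t ∂interarrivalLaw, ENNReal.ofReal (partialSum t m) ≤
      ∑ i ∈ Finset.range (m + 1), ENNReal.ofReal (t i) := by
    filter_upwards [ae_interarrival_nonneg] with t ht
    rw [partialSum, ENNReal.ofReal_sum_of_nonneg fun i _ => ht i]
  have h2 (i : ℕ) : ∫⁻ t, ENNReal.ofReal (t i) ∂interarrivalLaw =
      ∫⁻ x, ENNReal.ofReal x ∂expMeasure 1 :=
    (measurePreserving_eval_infinitePi (fun _ : ℕ => expMeasure 1) i).lintegral_comp
      (f := fun x => ENNReal.ofReal x) (by fun_prop)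
  refine (lintegral_mono_ae h1).trans_eq ?_
  rw [lintegral_finsetSum _ fun i _ => by fun_prop, Finset.sum_congr rfl fun i _ => h2 i,
    Finset.sum_const, Finset.card_range, nsmul_eq_mul]
  push_cast
  rfl

theorem exists_half_le_interarrivalLaw :
    ∃ L : ℝ, 0 < L ∧ ∀ m : ℕ, 2⁻¹ ≤ interarrivalLaw {t | partialSum t m ≤ L * (m + 1)} := by
  set e := ∫⁻ x, ENNReal.ofReal x ∂expMeasure 1 with he
  have hetop : e ≠ ⊤ := by
    have h := lintegral_rpow_gammaMeasure_ne_top (a := 1) (q := 1) one_pos zero_le_one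
    simp only [Real.rpow_one] at h
    exact h
  -- Markov: the mean of the partial sum is at most (m+1)e, so a level of at least twice that
  -- suffices; the extra 1 makes L positive without knowing e > 0.
  refine ⟨2 * e.toReal + 1, by positivity, fun m => ?_⟩
  have hpos : 0 < (2 * e.toReal + 1) * (m + 1) := by positivity
  set l := (2 * e.toReal + 1) * (m + 1) with hl
  have hmeas : MeasurableSet {t | partialSum t m ≤ l} :=
    measurableSet_le (measurable_partialSum m) measurable_const
  have hcompl : interarrivalLaw {t | partialSum t m ≤ l}ᶜ ≤ 2⁻¹ := by
    have hsub : {t | partialSum t m ≤ l}ᶜ ⊆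
        {t | ENNReal.ofReal l ≤ ENNReal.ofReal (partialSum t m)} := by
      intro t ht
      have hlt : ¬ partialSum t m ≤ l := ht
      exact ENNReal.ofReal_le_ofReal (not_le.1 hlt).le
    have hM := meas_ge_le_lintegral_div (μ := interarrivalLaw)
      (measurable_partialSum m).ennreal_ofReal.aemeasurable
      (ENNReal.ofReal_pos.2 hpos).ne' ENNReal.ofReal_ne_top
    refine (measure_mono hsub).trans (hM.trans (ENNReal.div_le_of_le_mul ?_))
    refine (lintegral_partialSum_le m).trans ?_
    have h2 : (2⁻¹ : ℝ≥0∞) = ENNReal.ofReal (2⁻¹) := by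
      rw [ENNReal.ofReal_inv_of_pos two_pos]; simp
    have hm : ((m : ℝ≥0∞) + 1) = ENNReal.ofReal ((m : ℝ) + 1) := by
      rw [ENNReal.ofReal_add (by positivity) zero_le_one]; simp
    rw [← he, ← ENNReal.ofReal_toReal hetop, h2, hm, ← ENNReal.ofReal_mul (by positivity),
      ← ENNReal.ofReal_mul (by positivity)]
    refine ENNReal.ofReal_le_ofReal ?_
    rw [hl]
    nlinarith [ENNReal.toReal_nonneg (a := e)]
  have hadd := prob_add_prob_compl (μ := interarrivalLaw) hmeas
  by_contra! hlt
  have := ENNReal.add_lt_add_of_lt_of_le (by finiteness) hlt hcompl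
  rw [hadd, ENNReal.inv_two_add_inv_two] at this
  exact lt_irrefl _ this

theorem ofReal_le_restrict_Icc_Iic {h : ℝ} (h1 : h ≤ 1) :
    ENNReal.ofReal h ≤ volume.restrict (Icc (0 : ℝ) 1) (Iic h) := by
  rw [Measure.restrict_apply measurableSet_Iic]
  calc ENNReal.ofReal h = volume (Icc (0 : ℝ) h) := by simp
    _ ≤ volume (Iic h ∩ Icc (0 : ℝ) 1) :=
        measure_mono fun u hu => ⟨hu.2, hu.1, hu.2.trans h1⟩

/-- Root randomness for which the root is old enough to have no younger children. -/
def noYoungEvent : Set Noise := Ici (1 / 2) ×ˢ (Iic 1 ×ˢ {t | 1 < t 0})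

/-- Randomness of the older child of the root for which that child has many younger children. -/
def manyYoungEvent (h l : ℝ) (m : ℕ) : Set Noise :=
  Iic h ×ˢ (Ioi 1 ×ˢ {t | partialSum t m ≤ l})

theorem measurableSet_noYoungEvent : MeasurableSet noYoungEvent :=
  measurableSet_Ici.prod (measurableSet_Iic.prod
    (measurableSet_lt measurable_const (measurable_pi_apply 0)))

theorem measurableSet_manyYoungEvent (h l : ℝ) (m : ℕ) : MeasurableSet (manyYoungEvent h l m) :=
  measurableSet_Iic.prod (measurableSet_Ioi.prod
    (measurableSet_le (measurable_partialSum m) measurable_const))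

theorem noiseLaw_noYoungEvent_ne_zero {δ : ℝ} (hδ : -1 < δ) (u : Word) :
    noiseLaw δ u noYoungEvent ≠ 0 := by
  have hg := isProbabilityMeasure_gammaMeasure (gammaShape_pos hδ u) one_pos
  rw [noiseLaw_eq, noYoungEvent, Measure.prod_prod, Measure.prod_prod]
  have h1 : volume.restrict (Icc (0 : ℝ) 1) (Ici (1 / 2)) ≠ 0 := by
    rw [Measure.restrict_apply measurableSet_Ici]
    intro h0
    have hsub : Icc (1 / 2 : ℝ) 1 ⊆ Ici (1 / 2) ∩ Icc 0 1 :=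
      fun x hx => ⟨hx.1, by linarith [hx.1], hx.2⟩
    have := measure_mono_null hsub h0
    norm_num at this
  have h3 : interarrivalLaw {t | 1 < t 0} = expMeasure 1 (Ioi 1) :=
    (measurePreserving_eval_infinitePi (fun _ : ℕ => expMeasure 1) 0).measure_preimage
      measurableSet_Ioi.nullMeasurableSet
  rw [h3]
  exact mul_ne_zero h1 (mul_ne_zero (gammaMeasure_Iic_one_ne_zero (gammaShape_pos hδ u))
    (gammaMeasure_Ioi_one_ne_zero one_pos))

/-- Since 1/(2+δ) ≤ 1, a ≥ 1/2 gives a^(1/(2+δ)) ≥ 1/2, so the total intensity is at most 1 and the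
first arrival comes too late. -/
theorem numYoung_nil_eq_zero {δ : ℝ} (hδ : -1 < δ) {ω : Sample} (hω : ∀ u, GoodNoise (ω u))
    (h : ω [] ∈ noYoungEvent) : numYoung δ ω [] = 0 := by
  obtain ⟨ha, hg, ht⟩ := h
  simp only [mem_Ici, mem_Iic, mem_ofPred_eq] at ha hg ht
  rw [numYoung_eq hδ hω]
  refine arrivalCount_eq_zero (hω []).interarrival_nonneg ?_
  rw [age_nil]
  have hg0 : 0 < gam ω [] := (hω []).gam_pos
  have hg1 : gam ω [] ≤ 1 := hg
  have ha0 : 0 < unif ω [] := (hω []).unif_pos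
  have ha1 : unif ω [] ≤ 1 := (hω []).unif_le_one
  have ha2 : 1 / 2 ≤ unif ω [] := ha
  have hb : 1 / (2 + δ) ≤ 1 := by rw [div_le_one (by linarith)]; linarith
  have hpow : 1 / 2 ≤ unif ω [] ^ (1 / (2 + δ)) := by
    have := Real.rpow_le_rpow_of_exponent_ge ha0 ha1 hb
    rw [Real.rpow_one] at this
    linarith
  have hinv : 1 / unif ω [] ^ (1 / (2 + δ)) ≤ 2 := by
    rw [div_le_iff₀ (by linarith)]; linarith
  have : gam ω [] * (1 / unif ω [] ^ (1 / (2 + δ)) - 1) ≤ 1 := by nlinarith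
  linarith

/-- The bound on U makes the total intensity at least Γl ≥ l for every root age, as a ≤ 1 only
helps. -/
theorem lt_numYoung_singleton_zero {δ : ℝ} (hδ : -1 < δ) {ω : Sample}
    (hω : ∀ u, GoodNoise (ω u)) {l : ℝ} (hl : 0 ≤ l) {m : ℕ}
    (h : ω [0] ∈ manyYoungEvent ((l + 1) ^ (-(1 + δ))) l m) : m < numYoung δ ω [0] := by
  obtain ⟨hU, hg, ht⟩ := h
  simp only [mem_Iic, mem_Ioi, mem_ofPred_eq] at hU hg ht
  have h1 : (0 : ℝ) < 1 + δ := by linarith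
  have h2 : (0 : ℝ) < 2 + δ := by linarith
  have hU0 : 0 < unif ω [0] := (hω [0]).unif_pos
  have ha : 0 < unif ω [] := (hω []).unif_pos
  have hg1 : 1 < gam ω [0] := hg
  rw [numYoung_eq hδ hω, age_singleton_zero_rpow hδ hω]
  refine lt_arrivalCount_of_partialSum_le (hω [0]).interarrival_nonneg (hω [0]).unbounded
    (ht.trans ?_)
  have hUpow : unif ω [0] ^ (1 / (1 + δ)) ≤ (l + 1)⁻¹ := by
    have hle : unif ω [0] ≤ (l + 1) ^ (-(1 + δ)) := hU
    have := Real.rpow_le_rpow hU0.le hle (by positivity : 0 ≤ 1 / (1 + δ))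
    rwa [← Real.rpow_mul (by positivity), neg_mul, mul_one_div_cancel h1.ne',
      Real.rpow_neg_one] at this
  have hapow : unif ω [] ^ (1 / (2 + δ)) ≤ 1 :=
    Real.rpow_le_one ha.le (hω []).unif_le_one (by positivity)
  have hUpos := Real.rpow_pos_of_pos hU0 (1 / (1 + δ))
  have hapos := Real.rpow_pos_of_pos ha (1 / (2 + δ))
  have hprod : unif ω [0] ^ (1 / (1 + δ)) * unif ω [] ^ (1 / (2 + δ)) ≤ (l + 1)⁻¹ :=
    (mul_le_of_le_one_right hUpos.le hapow).trans hUpow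
  have hinv : l + 1 ≤ 1 / (unif ω [0] ^ (1 / (1 + δ)) * unif ω [] ^ (1 / (2 + δ))) := by
    rw [one_div]
    exact (le_inv_comm₀ (by positivity) (by positivity)).1 hprod
  nlinarith

theorem rootBias_eq_of_numYoung_nil_eq_zero {δ : ℝ} {ω : Sample} (h : numYoung δ ω [] = 0) :
    rootBias (numChildren δ ω) = numChildren δ ω [0] := by
  have hc : numChildren δ ω [] = 1 := by rw [numChildren, h, numOld_nil]
  simp [rootBias, hc]

/-- The root event and the older-child event involve independent noises; only the constraint on U
has a probability that decays, like x^(-(1+δ)). -/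
theorem le_biasLaw {δ : ℝ} (hδ : -1 < δ) {r : ℝ} (hr : 1 + δ ≤ r) :
    ∃ c : ℝ≥0∞, c ≠ 0 ∧ ∀ᶠ x : ℝ in atTop,
      c * ENNReal.ofReal (x ^ (-r)) ≤ biasLaw δ hδ (Ici x) := by
  have hprob := isProbabilityMeasure_noiseLaw hδ
  have hg := isProbabilityMeasure_gammaMeasure (gammaShape_pos hδ [0]) one_pos
  obtain ⟨L, hL, hhalf⟩ := exists_half_le_interarrivalLaw
  set G := gammaMeasure (gammaShape δ [0]) 1 (Ioi 1) with hG
  have hG0 : G ≠ 0 := gammaMeasure_Ioi_one_ne_zero (gammaShape_pos hδ [0])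
  have hN0 := noiseLaw_noYoungEvent_ne_zero hδ []
  set N := noiseLaw δ [] noYoungEvent with hN
  have hD : ENNReal.ofReal ((3 * L + 1) ^ (-(1 + δ))) ≠ 0 :=
    (ENNReal.ofReal_pos.2 (Real.rpow_pos_of_pos (by positivity) _)).ne'
  refine ⟨N * (ENNReal.ofReal ((3 * L + 1) ^ (-(1 + δ))) * (G * 2⁻¹)),
    mul_ne_zero hN0 (mul_ne_zero hD (mul_ne_zero hG0 (by simp))), ?_⟩
  filter_upwards [eventually_ge_atTop 1] with x hx
  have hx0 : 0 < x := by linarith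
  set m := ⌈x⌉₊ with hm
  have hxm : x ≤ m := Nat.le_ceil x
  have hmx : (m : ℝ) < x + 1 := Nat.ceil_lt_add_one hx0.le
  set l := L * (m + 1) with hl
  have hl0 : 0 ≤ l := by positivity
  set h := (l + 1) ^ (-(1 + δ)) with hh
  have hsub : ∀ᵐ ω ∂sampleLaw δ hδ,
      ω ∈ (fun ω : Sample => (ω [], ω [0])) ⁻¹' (noYoungEvent ×ˢ manyYoungEvent h l m) →
      ω ∈ {ω | x ≤ rootBias (numChildren δ ω)} := by
    filter_upwards [ae_good hδ] with ω hω hmem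
    rw [rootBias_eq_of_numYoung_nil_eq_zero (numYoung_nil_eq_zero hδ hω hmem.1),
      numChildren]
    have hlt : (m : ℝ) < numYoung δ ω [0] := by
      exact_mod_cast lt_numYoung_singleton_zero hδ hω hl0 hmem.2
    push_cast
    have : (0 : ℝ) ≤ numOld [0] := by positivity
    linarith
  rw [biasLaw_Ici]
  refine le_trans ?_ (measure_mono_ae
    (s := (fun ω : Sample => (ω [], ω [0])) ⁻¹' (noYoungEvent ×ˢ manyYoungEvent h l m)) hsub)
  have hmp := measurePreserving_eval_pair_sampleLaw hδ (by simp : ([] : Word) ≠ [0])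
  rw [hmp.measure_preimage (measurableSet_noYoungEvent.prod
    (measurableSet_manyYoungEvent h l m)).nullMeasurableSet, Measure.prod_prod, ← hN, mul_assoc]
  refine mul_le_mul_right ?_ N
  rw [noiseLaw_eq, manyYoungEvent, Measure.prod_prod, Measure.prod_prod, mul_right_comm]
  refine mul_le_mul' ?_ (mul_le_mul_right (hhalf m) G)
  have hh1 : h ≤ 1 := Real.rpow_le_one_of_one_le_of_nonpos (by linarith) (by linarith)
  refine le_trans ?_ (ofReal_le_restrict_Icc_Iic hh1)
  rw [← ENNReal.ofReal_mul (by positivity)]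
  refine ENNReal.ofReal_le_ofReal ?_
  calc (3 * L + 1) ^ (-(1 + δ)) * x ^ (-r)
      ≤ (3 * L + 1) ^ (-(1 + δ)) * x ^ (-(1 + δ)) := by
        gcongr
    _ = ((3 * L + 1) * x) ^ (-(1 + δ)) := (Real.mul_rpow (by positivity) hx0.le).symm
    -- For x ≥ 1, l + 1 = L(m+1) + 1 ≤ L(x+2) + 1 ≤ (3L+1)x.
    _ ≤ h := by
        refine Real.rpow_le_rpow_of_nonpos (by positivity) ?_ (by linarith)
        rw [hl]
        nlinarith

theorem liminf_pos_of_eventually_le {f : ℝ → ℝ≥0∞} {r : ℝ} {c : ℝ≥0∞} (hc : c ≠ 0)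
    (h : ∀ᶠ x : ℝ in atTop, c * ENNReal.ofReal (x ^ (-r)) ≤ f x) :
    0 < liminf (fun x : ℝ => f x / ENNReal.ofReal (x ^ (-r))) atTop := by
  refine lt_of_lt_of_le (pos_iff_ne_zero.2 hc) (le_liminf_of_le (by isBoundedDefault) ?_)
  filter_upwards [h, eventually_gt_atTop 0] with x hx hx0
  have hpos := ENNReal.ofReal_pos.2 (Real.rpow_pos_of_pos hx0 (-r))
  exact (ENNReal.le_div_iff_mul_le (Or.inl hpos.ne') (Or.inl ENNReal.ofReal_ne_top)).2 hx

end PolyaPointTree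

theorem theorem14 (δ τ : ℝ) (hδ : -1 < δ) (hτ : τ = 3 + δ) :
    (δ < 0 → 0 < liminf (fun x : ℝ => PolyaPointTree.biasLaw δ hδ (Ici x) /
        ENNReal.ofReal (x ^ (-(3 * τ - 4)))) atTop) ∧
    (0 ≤ δ → 0 < liminf (fun x : ℝ => PolyaPointTree.biasLaw δ hδ (Ici x) /
        ENNReal.ofReal (x ^ (-(2 * τ - 1)))) atTop) ∧
    (-(1 / 2) ≤ δ → δ < 0 → limsup (fun x : ℝ => PolyaPointTree.biasLaw δ hδ (Ici x) /
        ENNReal.ofReal (x ^ (-(3 - τ)))) atTop < ⊤) ∧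
    (δ = 0 → limsup (fun x : ℝ => PolyaPointTree.biasLaw δ hδ (Ici x) /
        ENNReal.ofReal (x ^ (-1 : ℝ))) atTop < ⊤) ∧
    (0 < δ → limsup (fun x : ℝ => PolyaPointTree.biasLaw δ hδ (Ici x) /
        ENNReal.ofReal (x ^ (-(τ - 3)))) atTop < ⊤) := by
  refine ⟨fun _ => ?_, fun _ => ?_, fun h1 h2 => ?_, fun h => ?_, fun h => ?_⟩
  -- Here r = 5+3δ, and r ≥ 1+δ because δ > -1; in the next case r = 5+2δ.
  · obtain ⟨c, hc, hev⟩ := PolyaPointTree.le_biasLaw hδ (r := 3 * τ - 4) (by linarith)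
    exact PolyaPointTree.liminf_pos_of_eventually_le hc hev
  · obtain ⟨c, hc, hev⟩ := PolyaPointTree.le_biasLaw hδ (r := 2 * τ - 1) (by linarith)
    exact PolyaPointTree.liminf_pos_of_eventually_le hc hev
  -- Here r = -δ, and -δ ≤ 1+δ is exactly δ ≥ -1/2.
  · obtain ⟨C, hC, hev⟩ := PolyaPointTree.biasLaw_le hδ (k := 0) (r := 3 - τ)
      (by push_cast; linarith) (by push_cast; linarith) (by linarith)
    exact PolyaPointTree.limsup_lt_top_of_eventually_le hC hev
  · obtain ⟨C, hC, hev⟩ := PolyaPointTree.biasLaw_le hδ (k := 0) (r := 1)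
      (by push_cast; linarith) (by push_cast; linarith) (by linarith)
    exact PolyaPointTree.limsup_lt_top_of_eventually_le hC hev
  -- With k = ⌊δ⌋, r = δ < k+1 ≤ 1+δ, so the moment order k+1 is both admissible and large enough.
  · have hfl := Nat.floor_le h.le
    have hlt := Nat.lt_floor_add_one δ
    obtain ⟨C, hC, hev⟩ := PolyaPointTree.biasLaw_le hδ (k := ⌊δ⌋₊) (r := τ - 3)
      (by linarith) (by linarith) (by linarith)
    exact PolyaPointTree.limsup_lt_top_of_eventually_le hC hev

end
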